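/- Let $\ell \ge 2$ be an integer. A finite simple graph is called $C_m$-free if it does not contain the cycle of length $m$ as a (not necessarily induced) subgraph. Let $\chi(G)$ denote the chromatic number of $G$ and let $\log$ be the natural logarithm. (a) There exist a constant $C > 0$ and an integer $N$, both depending only on $\ell$, such that every $C_{2\ell+1}$-free graph $G$ on $n \ge N$ vertices satisfies $$\chi(G) \le C \left(\frac{n}{\log n}\right)^{1/(\ell+1)}.$$ (b) There exist a constant $C > 0$ and an integer $N$, both depending only on $\ell$, such that every $C_{2\ell}$-free graph $G$ on $n \ge N$ vertices satisfies $$\chi(G) \le C\, \frac{n^{1/\ell}}{\log n}.$$ -/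

import Mathlib

universe u

section

open scoped Classical

/-! Both bounds come from large independent sets. If every large induced subgraph `R` contains an
independent set of size about `|R|^(1-a) (log |R|)^b`, deleting such sets as colour classes uses
`O(n^a / (log n)^b)` colours (`exists_coloring_of_indep`, `exists_chromaticNumber_le_of_indep`);
here `a = 1/l`, `b = 1` for `C_{2l}` and `a = b = 1/(l+1)` for `C_{2l+1}`.

The logarithm comes from local sparsity. In a `C_m`-free graph every subset of a neighbourhood spans
linearly many edges, since a long path there closes up through the centre. For maximum degree at
most `d`, a uniformly random independent set then has expected size of order `n log d / d`
(`exists_indep_of_locally_sparse`).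

Even case: breadth-first layers of a `C_{2l}`-free graph span few edges. High minimum degree would
make them grow past `n`, so every induced subgraph has a vertex of degree `O(n^(1/l))`. Half of the
vertices then induce a graph of maximum degree `O(n^(1/l))`, to which the sparse theorem applies.

Odd case: put `q = (n / log n)^(1/(l+1))`; an independent set of order `n / q` is wanted. If some
half of the vertices induces maximum degree at most `q log n`, the sparse theorem suffices.
Otherwise every half contains a vertex of large degree, and layers around it have independent
subsets of proportional size. Either the layers grow to size `q^l log n = n / q`, or one of these
subsets has a closed neighbourhood only `O(q)` times larger and can be chosen greedily.

Both layer arguments order a layer lexicographically by ancestry. Along an increasing sequence the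
branches below the lowest common ancestor separate exactly once, so a segment of any prescribed
length across the separation closes through the tree to a cycle of the required length. -/

namespace CycleFreeColoring

/-! ### Monotone zigzag paths and cycles as vertex sequences. -/

/-- A bipartite edge set with more than `t (|A| + |B|)` edges contains a zigzag path that is
monotone for prescribed orders on both sides. -/
lemma exists_monotone_zigzag {V α β : Type*} [LinearOrder α] [LinearOrder β]
    (o : V → α) (o' : V → β) (ho : Function.Injective o) (ho' : Function.Injective o')
    (A B : Finset V) (t : ℕ) : ∀ E : Finset (V × V), (∀ e ∈ E, e.1 ∈ A ∧ e.2 ∈ B) →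
    t * (A.card + B.card) < E.card →
    ∃ a b : ℕ → V, (∀ k ≤ t, (a k, b k) ∈ E) ∧
      ∀ k < t, (a (k + 1), b k) ∈ E ∧ o (a k) < o (a (k + 1)) ∧ o' (b k) < o' (b (k + 1)) := by
  induction t with
  | zero =>
    intro E _ h
    obtain ⟨e, he⟩ := Finset.card_pos.mp (by simpa using h)
    exact ⟨fun _ => e.1, fun _ => e.2, fun _ _ => he, fun k hk => by omega⟩
  | succ t ih =>
    intro E hE h
    -- Deleting the last edge at each vertex of `A`, then the last remaining edge at each vertex of
    -- `B`, costs at most `|A| + |B|` edges. The final edge of a zigzag in `E₂` can therefore be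
    -- extended by one step on each side.
    set E₁ := E.filter (fun e => ∃ b', (e.1, b') ∈ E ∧ o' e.2 < o' b') with hE₁
    set E₂ := E₁.filter (fun e => ∃ a', (a', e.2) ∈ E₁ ∧ o e.1 < o a') with hE₂
    have h₁ : (E \ E₁).card ≤ A.card := by
      refine Finset.card_le_card_of_injOn Prod.fst (fun e he => ?_) ?_
      · exact (hE e (Finset.mem_sdiff.mp he).1).1
      · rintro ⟨a, b⟩ he ⟨a', b'⟩ he' (rfl : a = a')
        simp only [hE₁, Finset.coe_sdiff, Set.mem_sdiff, Finset.mem_coe, Finset.mem_filter,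
          not_and, not_exists, not_lt] at he he'
        have := ho' (le_antisymm (he'.2 he'.1 _ he.1) (he.2 he.1 _ he'.1))
        rw [this]
    have h₂ : (E₁ \ E₂).card ≤ B.card := by
      refine Finset.card_le_card_of_injOn Prod.snd (fun e he => ?_) ?_
      · exact (hE e (Finset.filter_subset _ _ (Finset.mem_sdiff.mp he).1)).2
      · rintro ⟨a, b⟩ he ⟨a', b'⟩ he' (rfl : b = b')
        simp only [hE₂, Finset.coe_sdiff, Set.mem_sdiff, Finset.mem_coe,
          Finset.mem_filter (s := E₁), not_and, not_exists, not_lt] at he he'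
        have := ho (le_antisymm (he'.2 he'.1 _ he.1) (he.2 he.1 _ he'.1))
        rw [this]
    have s₁ : E₁ ⊆ E := Finset.filter_subset _ _
    have s₂ : E₂ ⊆ E₁ := Finset.filter_subset _ _
    have e₁ := Finset.card_sdiff_add_card_eq_card s₁
    have e₂ := Finset.card_sdiff_add_card_eq_card s₂
    have h21 : ∀ {e}, e ∈ E₂ → e ∈ E₁ := fun he => Finset.filter_subset _ _ he
    have h10 : ∀ {e}, e ∈ E₁ → e ∈ E := fun he => Finset.filter_subset _ _ he
    obtain ⟨a, b, hab, hstep⟩ := ih E₂ (fun e he => hE e (h10 (h21 he))) (by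
      have : (t + 1) * (A.card + B.card) = t * (A.card + B.card) + (A.card + B.card) := by ring
      omega)
    obtain ⟨a', ha', hlt⟩ := (Finset.mem_filter.mp (hab t le_rfl)).2
    obtain ⟨b', hb', hlt'⟩ := (Finset.mem_filter.mp ha').2
    refine ⟨fun k => if k ≤ t then a k else a', fun k => if k ≤ t then b k else b', ?_, ?_⟩
    · intro k hk
      by_cases hkt : k ≤ t
      · simpa [hkt] using h10 (h21 (hab k hkt))
      · simpa [hkt] using hb'
    · intro k hk
      by_cases hkt : k < t
      · have h1 : k ≤ t := hkt.le
        have h2 : k + 1 ≤ t := hkt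
        simp only [h1, h2, if_true]
        exact ⟨h10 (h21 (hstep k hkt).1), (hstep k hkt).2⟩
      · obtain rfl : k = t := by omega
        simpa using ⟨h10 ha', hlt, hlt'⟩

/-- A dense set of edges between `A` and `B`, all increasing for an order `o`, contains a zigzag
path whose vertices in `A` are increasing. -/
lemma exists_zigzag_path {V α : Type*} [LinearOrder α] {G : SimpleGraph V}
    (o : V → α) (ho : Function.Injective o) (A B : Finset V) (t : ℕ) (E : Finset (V × V))
    (hE : ∀ e ∈ E, e.1 ∈ A ∧ e.2 ∈ B ∧ G.Adj e.1 e.2 ∧ o e.1 < o e.2)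
    (h : t * (A.card + B.card) < E.card) :
    ∃ z : ℕ → V, (∀ k ≤ 2 * t, G.Adj (z k) (z (k + 1))) ∧
      Set.InjOn z (Set.Iic (2 * t + 1)) ∧ (∀ k ≤ t, z (2 * k) ∈ A ∧ z (2 * k + 1) ∈ B) ∧
      ∀ k < t, o (z (2 * k)) < o (z (2 * k + 2)) := by
  -- With the dual order on the second side, the `a k` increase and the `b k` decrease. As `a t < b
  -- t`, every `a k` lies below every `b j`, so the vertices are distinct even when `A` and `B`
  -- overlap.
  obtain ⟨a, b, hab, hstep⟩ := exists_monotone_zigzag o (fun v => OrderDual.toDual (o v)) ho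
    (fun x y hxy => ho (by simpa using hxy)) A B t E (fun e he => ⟨(hE e he).1, (hE e he).2.1⟩) h
  have ha : ∀ k, ∀ j, k ≤ j → j ≤ t → o (a k) ≤ o (a j) := by
    intro k j hkj
    induction j, hkj using Nat.le_induction with
    | base => intro _; exact le_rfl
    | succ j _ ih => intro hj; exact (ih (by omega)).trans (hstep j (by omega)).2.1.le
  have hb : ∀ k, ∀ j, k ≤ j → j ≤ t → o (b j) ≤ o (b k) := by
    intro k j hkj
    induction j, hkj using Nat.le_induction with
    | base => intro _; exact le_rfl
    | succ j _ ih =>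
      intro hj
      have := (hstep j (by omega)).2.2
      simp only [OrderDual.toDual_lt_toDual] at this
      exact this.le.trans (ih (by omega))
  have hlt : ∀ k ≤ t, ∀ j ≤ t, o (a k) < o (b j) := fun k hk j hj =>
    (ha k t hk le_rfl).trans_lt ((hE _ (hab t le_rfl)).2.2.2.trans_le (hb j t hj le_rfl))
  have hainj : ∀ k ≤ t, ∀ j ≤ t, a k = a j → k = j := by
    have : ∀ k j, k < j → j ≤ t → a k ≠ a j := fun k j hkj hj hEq => by
      have h1 := (hstep k (by omega)).2.1
      have h2 := ha (k + 1) j hkj hj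
      rw [hEq] at h1
      exact absurd (h1.trans_le h2) (lt_irrefl _)
    intro k hk j hj hEq
    rcases lt_trichotomy k j with h | h | h
    · exact absurd hEq (this k j h hj)
    · exact h
    · exact absurd hEq.symm (this j k h hk)
  have hbinj : ∀ k ≤ t, ∀ j ≤ t, b k = b j → k = j := by
    have : ∀ k j, k < j → j ≤ t → b k ≠ b j := fun k j hkj hj hEq => by
      have h1 := (hstep k (by omega)).2.2
      simp only [OrderDual.toDual_lt_toDual] at h1
      have h2 := hb (k + 1) j hkj hj
      rw [hEq] at h1
      exact absurd (h1.trans_le h2) (lt_irrefl _)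
    intro k hk j hj hEq
    rcases lt_trichotomy k j with h | h | h
    · exact absurd hEq (this k j h hj)
    · exact h
    · exact absurd hEq.symm (this j k h hk)
  set z : ℕ → V := fun k => if k % 2 = 0 then a (k / 2) else b (k / 2) with hz
  have z0 : ∀ k, z (2 * k) = a k := fun k => by simp [hz]
  have z1 : ∀ k, z (2 * k + 1) = b k := fun k => by
    have h1 : (2 * k + 1) % 2 = 1 := by omega
    have h2 : (2 * k + 1) / 2 = k := by omega
    simp [hz, h1, h2]
  refine ⟨z, ?_, ?_, ?_, ?_⟩
  · intro k hk
    obtain ⟨c, rfl | rfl⟩ := Nat.even_or_odd' k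
    · rw [z0, z1]
      exact (hE _ (hab c (by omega))).2.2.1
    · rw [z1, show 2 * c + 1 + 1 = 2 * (c + 1) by ring, z0]
      exact (hE _ (hstep c (by omega)).1).2.2.1.symm
  · intro k hk j hj hkj
    simp only [Set.mem_Iic] at hk hj
    obtain ⟨c, rfl | rfl⟩ := Nat.even_or_odd' k <;> obtain ⟨d, rfl | rfl⟩ := Nat.even_or_odd' j
    · rw [z0, z0] at hkj
      rw [hainj c (by omega) d (by omega) hkj]
    · rw [z0, z1] at hkj
      exact absurd (hlt c (by omega) d (by omega)) (by rw [hkj]; exact lt_irrefl _)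
    · rw [z0, z1] at hkj
      exact absurd (hlt d (by omega) c (by omega)) (by rw [hkj]; exact lt_irrefl _)
    · rw [z1, z1] at hkj
      rw [hbinj c (by omega) d (by omega) hkj]
  · intro k hk
    rw [z0, z1]
    exact ⟨(hE _ (hab k hk)).1, (hE _ (hab k hk)).2.1⟩
  · intro k hk
    rw [z0, show 2 * k + 2 = 2 * (k + 1) by ring, z0]
    exact (hstep k hk).2.1

/-- A closed sequence of `m` distinct vertices gives a copy of the cycle of length `m`. -/
lemma cycleGraph_isContained_of_seq {V : Type*} {G : SimpleGraph V} {m : ℕ} (f : ℕ → V)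
    (hf : Set.InjOn f (Set.Iio m)) (hadj : ∀ k, k + 1 < m → G.Adj (f k) (f (k + 1)))
    (hclose : G.Adj (f (m - 1)) (f 0)) : (SimpleGraph.cycleGraph m).IsContained G := by
  have key : ∀ u v : Fin m, (v - u).val = 1 → G.Adj (f u) (f v) := by
    intro u v huv
    have hu := u.2
    have hv := v.2
    rw [Fin.sub_def] at huv
    simp only at huv
    rcases lt_or_ge v.val u.val with h | h
    · rw [Nat.mod_eq_of_lt (by omega)] at huv
      have h1 : u.val = m - 1 := by omega
      have h2 : v.val = 0 := by omega
      rw [h1, h2]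
      exact hclose
    · have : m - u.val + v.val = (v.val - u.val) + m := by omega
      rw [this, Nat.add_mod_right, Nat.mod_eq_of_lt (by omega)] at huv
      have h1 : v.val = u.val + 1 := by omega
      rw [h1]
      exact hadj _ (by omega)
  refine ⟨⟨⟨fun i => f i, ?_⟩, ?_⟩⟩
  · intro u v huv
    rcases SimpleGraph.cycleGraph_adj'.mp huv with h | h
    · exact (key _ _ h).symm
    · exact key _ _ h
  · intro u v huv
    exact Fin.ext (hf u.2 v.2 huv)

/-! ### Search trees, ancestors and cycles through a common ancestor. -/

/-- A breadth-first search tree of `G`, described up to depth `r`; vertices that are not reached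
have level larger than `r`. -/
structure SearchTree {V : Type*} (G : SimpleGraph V) (r : ℕ) (root : V) where
  lev : V → ℕ
  par : V → V
  lev_eq_zero : ∀ u, lev u = 0 ↔ u = root
  adj_par : ∀ u, 0 < lev u → lev u ≤ r → G.Adj (par u) u
  lev_par : ∀ u, 0 < lev u → lev u ≤ r → lev (par u) + 1 = lev u
  lev_adj : ∀ u w, G.Adj u w → lev u ≤ r → lev w ≤ lev u + 1

lemma exists_searchTree {V : Type*} (G : SimpleGraph V) (r : ℕ) (root : V) :
    Nonempty (SearchTree G r root) := by
  -- `dist` is `0` between disconnected vertices, so unreachable ones get the value `r + 1`, which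
  -- keeps them out of the layers up to `r`.
  set lev : V → ℕ := fun u => if G.Reachable root u then G.dist root u else r + 1 with hlev
  have hreach : ∀ u, lev u ≤ r → G.Reachable root u ∧ lev u = G.dist root u := by
    intro u hu
    by_cases h : G.Reachable root u
    · exact ⟨h, by simp [hlev, h]⟩
    · simp [hlev, h] at hu
  have hpar : ∀ u, ∃ p, 0 < lev u → lev u ≤ r → G.Adj p u ∧ lev p + 1 = lev u := by
    intro u
    by_cases hu : 0 < lev u ∧ lev u ≤ r
    · obtain ⟨h, hd⟩ := hreach u hu.2
      obtain ⟨w, hw⟩ := h.symm.exists_walk_length_eq_dist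
      rw [SimpleGraph.dist_comm] at hw
      cases w with
      | nil => rw [hd, SimpleGraph.dist_self] at hu; omega
      | @cons _ p _ hup q =>
        have hr : G.Reachable root p := ⟨q.reverse⟩
        refine ⟨p, fun _ _ => ⟨hup.symm, ?_⟩⟩
        have h1 : G.dist root p ≤ q.length := by
          rw [SimpleGraph.dist_comm]; exact SimpleGraph.dist_le q
        have h2 : G.dist root u ≤ G.dist root p + 1 := by
          obtain ⟨w', hw'⟩ := hr.exists_walk_length_eq_dist
          have := SimpleGraph.dist_le (w'.concat hup.symm)
          rw [SimpleGraph.Walk.length_concat] at this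
          omega
        have h3 : lev p = G.dist root p := by simp [hlev, hr]
        simp only [SimpleGraph.Walk.length_cons] at hw
        omega
    · exact ⟨u, fun h1 h2 => absurd ⟨h1, h2⟩ hu⟩
  choose par hp using hpar
  refine ⟨⟨lev, par, ?_, fun u h1 h2 => (hp u h1 h2).1, fun u h1 h2 => (hp u h1 h2).2, ?_⟩⟩
  · intro u
    constructor
    · intro h
      obtain ⟨h1, h2⟩ := hreach u (by omega)
      exact (h1.dist_eq_zero_iff.mp (h2 ▸ h)).symm
    · rintro rfl
      simp [hlev]
  · intro u w huw hu
    obtain ⟨h1, h2⟩ := hreach u hu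
    have hr : G.Reachable root w := h1.trans huw.reachable
    obtain ⟨w', hw'⟩ := h1.exists_walk_length_eq_dist
    have := SimpleGraph.dist_le (w'.concat huw)
    rw [SimpleGraph.Walk.length_concat] at this
    have h3 : lev w = G.dist root w := by simp [hlev, hr]
    omega

namespace SearchTree

variable {V : Type*} {G : SimpleGraph V} {r : ℕ} {root : V} (T : SearchTree G r root)

lemma lev_iterate_par {u : V} (hu : T.lev u ≤ r) {j : ℕ} (hj : j ≤ T.lev u) :
    T.lev (T.par^[j] u) + j = T.lev u := by
  induction j with
  | zero => simp
  | succ j ih =>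
    have h := ih (by omega)
    rw [Function.iterate_succ_apply']
    have := T.lev_par (T.par^[j] u) (by omega) (by omega)
    omega

lemma adj_iterate_par {u : V} (hu : T.lev u ≤ r) {j : ℕ} (hj : j < T.lev u) :
    G.Adj (T.par^[j + 1] u) (T.par^[j] u) := by
  rw [Function.iterate_succ_apply']
  have := T.lev_iterate_par hu hj.le
  exact T.adj_par _ (by omega) (by omega)

lemma iterate_par_ne_of_le {x y : V} {j k : ℕ} (hkj : k ≤ j)
    (h : T.par^[j] x ≠ T.par^[j] y) : T.par^[k] x ≠ T.par^[k] y := by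
  intro hk
  apply h
  obtain ⟨d, rfl⟩ := Nat.exists_eq_add_of_le' hkj
  rw [Function.iterate_add_apply, Function.iterate_add_apply, hk]

/-- A path between two vertices of a level that does not go above this level closes up to a cycle
through the lowest common ancestor. -/
lemma cycle_of_fork {i j s : ℕ} {x y : V} (hx : T.lev x = i) (hy : T.lev y = i) (hi : i ≤ r)
    (hj : 1 ≤ j) (hji : j ≤ i) (hxy : T.par^[j] x = T.par^[j] y)
    (hne : T.par^[j - 1] x ≠ T.par^[j - 1] y) (w : ℕ → V) (hw0 : w 0 = x) (hws : w s = y)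
    (hadj : ∀ k < s, G.Adj (w k) (w (k + 1))) (hinj : Set.InjOn w (Set.Iic s))
    (hlev : ∀ k ≤ s, i ≤ T.lev (w k)) (hs : 1 ≤ s) :
    (SimpleGraph.cycleGraph (s + 2 * j)).IsContained G := by
  have hlx : ∀ k ≤ j, T.lev (T.par^[k] x) + k = i := fun k hk =>
    hx ▸ T.lev_iterate_par (by omega) (by omega)
  have hly : ∀ k ≤ j, T.lev (T.par^[k] y) + k = i := fun k hk =>
    hy ▸ T.lev_iterate_par (by omega) (by omega)
  -- The cycle follows `w` from `x` to `y`, descends from `y` to the common ancestor `j` steps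
  -- below, and climbs back to `x`.
  set f : ℕ → V := fun k => if k ≤ s then w k else
    if k ≤ s + j then T.par^[k - s] y else T.par^[s + 2 * j - k] x with hf
  have f1 : ∀ k ≤ s, f k = w k := fun k hk => by simp [hf, hk]
  have f2 : ∀ k ≤ j, f (s + k) = T.par^[k] y := fun k hk => by
    rcases Nat.eq_zero_or_pos k with rfl | hk'
    · simp [hf, hws]
    · have h1 : ¬ (s + k ≤ s) := by omega
      have h2 : s + k ≤ s + j := by omega
      simp [hf, h2, hk'.ne']
  have f3 : ∀ k, 1 ≤ k → k ≤ j → f (s + 2 * j - k) = T.par^[k] x := fun k hk hkj => by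
    rcases Nat.eq_or_lt_of_le hkj with rfl | hk'
    · rw [show s + 2 * k - k = s + k by omega, f2 k le_rfl, hxy]
    · have h1 : ¬ (s + 2 * j - k ≤ s) := by omega
      have h2 : ¬ (s + 2 * j - k ≤ s + j) := by omega
      have h3 : s + 2 * j - (s + 2 * j - k) = k := by omega
      simp only [hf, h1, h2, h3, if_false]
  have cases : ∀ k < s + 2 * j, k ≤ s ∨ (∃ c, 1 ≤ c ∧ c ≤ j ∧ k = s + c) ∨
      ∃ c, 1 ≤ c ∧ c < j ∧ k = s + 2 * j - c := by
    intro k hk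
    by_cases h1 : k ≤ s
    · exact Or.inl h1
    by_cases h2 : k ≤ s + j
    · exact Or.inr (Or.inl ⟨k - s, by omega, by omega, by omega⟩)
    · exact Or.inr (Or.inr ⟨s + 2 * j - k, by omega, by omega, by omega⟩)
  have inj12 : ∀ k ≤ s, ∀ c, 1 ≤ c → c ≤ j → w k ≠ T.par^[c] y := fun k hk c hc hcj h => by
    have h1 := hlev k hk
    have h2 := hly c hcj
    rw [h] at h1
    omega
  have inj13 : ∀ k ≤ s, ∀ c, 1 ≤ c → c ≤ j → w k ≠ T.par^[c] x := fun k hk c hc hcj h => by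
    have h1 := hlev k hk
    have h2 := hlx c hcj
    rw [h] at h1
    omega
  have inj23 : ∀ c, 1 ≤ c → c ≤ j → ∀ d, 1 ≤ d → d < j → T.par^[c] y ≠ T.par^[d] x := by
    intro c hc hcj d hd hdj h
    have h1 := hly c hcj
    have h2 := hlx d hdj.le
    rw [h] at h1
    obtain rfl : c = d := by omega
    exact T.iterate_par_ne_of_le (show c ≤ j - 1 by omega) hne h.symm
  refine cycleGraph_isContained_of_seq f ?_ ?_ ?_
  · intro k hk k' hk' hkk
    simp only [Set.mem_Iio] at hk hk'
    rcases cases k hk with h | ⟨c, hc1, hc2, rfl⟩ | ⟨c, hc1, hc2, rfl⟩ <;>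
      rcases cases k' hk' with h' | ⟨d, hd1, hd2, rfl⟩ | ⟨d, hd1, hd2, rfl⟩
    · rw [f1 k h, f1 k' h'] at hkk
      exact hinj h h' hkk
    · rw [f1 k h, f2 d hd2] at hkk
      exact absurd hkk (inj12 k h d hd1 hd2)
    · rw [f1 k h, f3 d hd1 hd2.le] at hkk
      exact absurd hkk (inj13 k h d hd1 hd2.le)
    · rw [f1 k' h', f2 c hc2] at hkk
      exact absurd hkk.symm (inj12 k' h' c hc1 hc2)
    · rw [f2 c hc2, f2 d hd2] at hkk
      have h1 := hly c hc2
      have h2 := hly d hd2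
      rw [hkk] at h1
      omega
    · rw [f2 c hc2, f3 d hd1 hd2.le] at hkk
      exact absurd hkk (inj23 c hc1 hc2 d hd1 hd2)
    · rw [f1 k' h', f3 c hc1 hc2.le] at hkk
      exact absurd hkk.symm (inj13 k' h' c hc1 hc2.le)
    · rw [f2 d hd2, f3 c hc1 hc2.le] at hkk
      exact absurd hkk.symm (inj23 d hd1 hd2 c hc1 hc2)
    · rw [f3 c hc1 hc2.le, f3 d hd1 hd2.le] at hkk
      have h1 := hlx c hc2.le
      have h2 := hlx d hd2.le
      rw [hkk] at h1
      omega
  · intro k hk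
    by_cases h1 : k < s
    · rw [f1 k h1.le, f1 (k + 1) h1]
      exact hadj k h1
    by_cases h2 : k < s + j
    · obtain ⟨c, rfl⟩ := Nat.exists_eq_add_of_le (not_lt.mp h1)
      rw [f2 c (by omega), add_assoc, f2 (c + 1) (by omega)]
      exact (T.adj_iterate_par (by omega) (by omega)).symm
    · obtain ⟨c, hc, rfl⟩ : ∃ c, c + 1 ≤ j ∧ k = s + 2 * j - (c + 1) :=
        ⟨s + 2 * j - k - 1, by omega, by omega⟩
      rw [f3 (c + 1) (by omega) hc,
        show s + 2 * j - (c + 1) + 1 = s + 2 * j - c by omega, f3 c (by omega) (by omega)]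
      exact T.adj_iterate_par (by omega) (by omega)
  · rw [f3 1 le_rfl hj, f1 0 (by omega), hw0]
    exact T.adj_iterate_par (j := 0) (by omega) (by omega)

/-- A numbering of the vertices that orders each level lexicographically by the numbers of the
ancestors. -/
def key (N : ℕ) (e : V → ℕ) : ℕ → V → ℕ
  | 0, u => e u
  | k + 1, u => N * key N e k (T.par u) + e u

lemma key_injective {N : ℕ} {e : V → ℕ} (he : Function.Injective e) (hN : ∀ u, e u < N) (i : ℕ) :
    Function.Injective (T.key N e i) := by
  cases i with
  | zero => exact he
  | succ k =>
    intro u w h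
    apply he
    have := congrArg (· % N) h
    simpa [key, Nat.mod_eq_of_lt (hN _)] using this

/-- The key is a base-`N` number whose digits are the labels along the branch, oldest ancestor
first; dropping the last `j` digits leaves the key of the `j`-th ancestor. Hence passing to
ancestors preserves the weak order. -/
lemma key_div_pow {N : ℕ} {e : V → ℕ} (hN : ∀ u, e u < N) (j : ℕ) : ∀ (i : ℕ) (u : V), j ≤ i →
    T.key N e i u / N ^ j = T.key N e (i - j) (T.par^[j] u) := by
  induction j with
  | zero => simp
  | succ j ih =>
    intro i u hi
    obtain ⟨i, rfl⟩ : ∃ k, i = k + 1 := ⟨i - 1, by omega⟩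
    have hpos : 0 < N := (Nat.zero_le _).trans_lt (hN u)
    rw [pow_succ', ← Nat.div_div_eq_div_mul, key, Nat.mul_add_div hpos,
      Nat.div_eq_of_lt (hN u), add_zero, ih i _ (by omega), Function.iterate_succ_apply,
      Nat.add_sub_add_right]

/-- In a sequence of vertices of a level that is increasing in the lexicographic order, the
branches below the lowest common ancestor split at one place. -/
lemma exists_split {N : ℕ} {e : V → ℕ} (he : Function.Injective e) (hN : ∀ u, e u < N) {i t : ℕ}
    (hi : i ≤ r) (ht : 1 ≤ t) (u : ℕ → V) (hu : ∀ k ≤ t, T.lev (u k) = i)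
    (hmono : ∀ k < t, T.key N e i (u k) < T.key N e i (u (k + 1))) :
    ∃ j, 1 ≤ j ∧ j ≤ i ∧ ∃ c < t, ∀ x ≤ c, ∀ y, c < y → y ≤ t →
      T.par^[j] (u x) = T.par^[j] (u y) ∧ T.par^[j - 1] (u x) ≠ T.par^[j - 1] (u y) := by
  have hle : ∀ x y, x ≤ y → y ≤ t → T.key N e i (u x) ≤ T.key N e i (u y) := by
    intro x y hxy
    induction y, hxy using Nat.le_induction with
    | base => intro _; exact le_rfl
    | succ y _ ih => intro hy; exact (ih (by omega)).trans (hmono y (by omega)).le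
  have hroot : ∀ k ≤ t, T.par^[i] (u k) = root := fun k hk => by
    have := T.lev_iterate_par (u := u k) (by rw [hu k hk]; exact hi) (hu k hk).ge
    rw [hu k hk] at this
    exact (T.lev_eq_zero _).mp (by omega)
  have hroot' : ∀ k ≤ t, T.par^[i] (u k) = T.par^[i] (u 0) := fun k hk =>
    (hroot k hk).trans (hroot 0 (by omega)).symm
  have hex : ∃ j, ∀ k ≤ t, T.par^[j] (u k) = T.par^[j] (u 0) := ⟨i, hroot'⟩
  have hji : Nat.find hex ≤ i := Nat.find_min' hex hroot'
  -- `j` is the least height at which all branches agree; one step earlier, `d` is the first index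
  -- whose ancestor differs from that of `u 0`. Monotonicity of the keys forbids a return to the
  -- first ancestor after `d`.
  set j := Nat.find hex with hj
  have hjs : ∀ k ≤ t, T.par^[j] (u k) = T.par^[j] (u 0) := Nat.find_spec hex
  have hj1 : 1 ≤ j := by
    by_contra h
    have h0 : j = 0 := by omega
    rw [h0] at hjs
    have h1 := hjs 1 ht
    have h2 := hmono 0 ht
    simp only [Function.iterate_zero, id_eq] at h1
    rw [zero_add, h1] at h2
    exact lt_irrefl _ h2
  have hbad : ∃ k, k ≤ t ∧ T.par^[j - 1] (u k) ≠ T.par^[j - 1] (u 0) := by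
    have := Nat.find_min hex (m := j - 1) (by omega)
    push Not at this
    exact this
  set d := Nat.find hbad with hd
  obtain ⟨hdt, hdne⟩ : d ≤ t ∧ T.par^[j - 1] (u d) ≠ T.par^[j - 1] (u 0) := Nat.find_spec hbad
  have hd0 : d ≠ 0 := fun h => hdne (by rw [h])
  have hmono' : ∀ x y, x ≤ y → y ≤ t → T.key N e (i - (j - 1)) (T.par^[j - 1] (u x)) ≤
      T.key N e (i - (j - 1)) (T.par^[j - 1] (u y)) := fun x y hxy hy => by
    rw [← T.key_div_pow hN _ _ _ (by omega), ← T.key_div_pow hN _ _ _ (by omega)]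
    exact Nat.div_le_div_right (hle x y hxy hy)
  refine ⟨j, hj1, hji, d - 1, by omega, fun x hx y hy hyt =>
    ⟨(hjs x (by omega)).trans (hjs y hyt).symm, fun hEq => ?_⟩⟩
  have hx0 : T.par^[j - 1] (u x) = T.par^[j - 1] (u 0) := by
    by_contra h
    exact Nat.find_min hbad (m := x) (by omega) ⟨by omega, h⟩
  apply hdne
  apply T.key_injective he hN (i - (j - 1))
  apply le_antisymm
  · rw [← hx0, hEq]
    exact hmono' d y (by omega) hyt
  · exact hmono' 0 d (by omega) hdt

end SearchTree

/-! ### Sparse neighbourhoods and structure of the layers. -/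

/-- Sets inside a neighbourhood of a graph without a cycle of length `m` are sparse. -/
lemma sum_card_neighbors_le_of_subset_neighbors {V : Type*} [Fintype V] {G : SimpleGraph V} {m : ℕ}
    (hm : 3 ≤ m) (hfree : (SimpleGraph.cycleGraph m).Free G) (v : V) (S : Finset V)
    (hS : ∀ u ∈ S, G.Adj v u) :
    ∑ u ∈ S, (S.filter (G.Adj u)).card ≤ 4 * m * S.card := by
  set o : V → ℕ := fun u => (Fintype.equivFin V u).val with ho
  have hoi : Function.Injective o := fun x y h => (Fintype.equivFin V).injective (Fin.ext h)
  set E := (S ×ˢ S).filter (fun e => G.Adj e.1 e.2 ∧ o e.1 < o e.2) with hE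
  set E' := (S ×ˢ S).filter (fun e => G.Adj e.1 e.2 ∧ o e.2 < o e.1) with hE'
  have hcard : E.card ≤ m * (S.card + S.card) := by
    by_contra! hlt
    obtain ⟨z, hadj, hinj, hmem, -⟩ := exists_zigzag_path (G := G) o hoi S S m E (by
      intro e he
      simp only [hE, Finset.mem_filter, Finset.mem_product] at he
      tauto) hlt
    have hzS : ∀ k ≤ 2 * m + 1, z k ∈ S := by
      intro k hk
      obtain ⟨c, rfl | rfl⟩ := Nat.even_or_odd' k
      · exact (hmem c (by omega)).1
      · exact (hmem c (by omega)).2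
    -- The first `m - 1` vertices of the path, closed through `v`, form the forbidden cycle.
    refine hfree (cycleGraph_isContained_of_seq (fun k => if k < m - 1 then z k else v) ?_ ?_ ?_)
    · intro k hk k' hk' hkk
      simp only [Set.mem_Iio] at hk hk'
      by_cases h : k < m - 1 <;> by_cases h' : k' < m - 1 <;> simp only [h, h', if_true, if_false]
        at hkk
      · exact hinj (show k ≤ _ by omega) (show k' ≤ _ by omega) hkk
      · exact absurd hkk (hS _ (hzS k (by omega))).ne'
      · exact absurd hkk (hS _ (hzS k' (by omega))).ne
      · omega
    · intro k hk
      have h : k < m - 1 := by omega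
      by_cases h' : k + 1 < m - 1 <;> simp only [h, h', if_true, if_false]
      · exact hadj k (by omega)
      · exact (hS _ (hzS k (by omega))).symm
    · have h0 : 0 < m - 1 := by omega
      simp only [lt_irrefl, h0, if_true, if_false]
      exact hS _ (hzS 0 (by omega))
  have hsymm : E'.card = E.card := by
    refine Finset.card_bij (fun e _ => e.swap) ?_ ?_ ?_
    · rintro ⟨a, b⟩ he
      simp only [hE, hE', Finset.mem_filter, Finset.mem_product, Prod.swap] at he ⊢
      exact ⟨he.1.symm, he.2.1.symm, he.2.2⟩
    · intro a _ b _ h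
      exact Prod.swap_injective h
    · rintro ⟨a, b⟩ he
      refine ⟨(b, a), ?_, rfl⟩
      simp only [hE, hE', Finset.mem_filter, Finset.mem_product] at he ⊢
      exact ⟨he.1.symm, he.2.1.symm, he.2.2⟩
  have hsum : ∑ u ∈ S, (S.filter (G.Adj u)).card =
      ((S ×ˢ S).filter (fun e => G.Adj e.1 e.2)).card := by
    simp_rw [Finset.card_filter]
    rw [Finset.sum_product]
  have hsub : (S ×ˢ S).filter (fun e => G.Adj e.1 e.2) ⊆ E ∪ E' := by
    intro e he
    simp only [hE, hE', Finset.mem_filter, Finset.mem_union] at he ⊢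
    rcases lt_trichotomy (o e.1) (o e.2) with h | h | h
    · exact Or.inl ⟨he.1, he.2, h⟩
    · exact absurd (hoi h) he.2.ne
    · exact Or.inr ⟨he.1, he.2, h⟩
  have := Finset.card_le_card hsub
  have := Finset.card_union_le E E'
  rw [hsum]
  have : 4 * m * S.card = m * (S.card + S.card) + m * (S.card + S.card) := by ring
  omega

/-- Either there is a path with `t + 1` vertices along which a numbering is increasing, or there is
an independent set containing a `1 / t` proportion of the vertices. -/
lemma exists_increasing_path_or_indep {V : Type*} (G : SimpleGraph V) (o : V → ℕ)
    (ho : Function.Injective o) (t : ℕ) : ∀ S : Finset V, S.Nonempty →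
    (∃ u : ℕ → V, (∀ k ≤ t, u k ∈ S) ∧
      ∀ k < t, G.Adj (u k) (u (k + 1)) ∧ o (u k) < o (u (k + 1))) ∨
    ∃ I ⊆ S, G.IsIndepSet (I : Set V) ∧ S.card ≤ t * I.card := by
  induction t with
  | zero =>
    rintro S ⟨x, hx⟩
    exact Or.inl ⟨fun _ => x, fun _ _ => hx, fun k hk => by omega⟩
  | succ t ih =>
    intro S hS
    -- The vertices outside `S'` have no smaller neighbour in `S`, hence are independent. A path in
    -- `S'` can be extended at its lower end; an independent set found in `S'` competes with `S \
    -- S'` for size.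
    set S' := S.filter (fun u => ∃ w ∈ S, G.Adj w u ∧ o w < o u) with hS'
    have hsub : S' ⊆ S := Finset.filter_subset _ _
    have hI : G.IsIndepSet ((S \ S' : Finset V) : Set V) := by
      intro x hx y hy hxy hadj
      simp only [hS', Finset.coe_sdiff, Set.mem_sdiff, Finset.mem_coe, Finset.mem_filter, not_and,
        not_exists] at hx hy
      rcases lt_or_gt_of_ne (fun h => hxy (ho h)) with h | h
      · exact hy.2 hy.1 x hx.1 hadj h
      · exact hx.2 hx.1 y hy.1 hadj.symm h
    have hc := Finset.card_sdiff_add_card_eq_card hsub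
    rcases S'.eq_empty_or_nonempty with h0 | hne
    · refine Or.inr ⟨S \ S', Finset.sdiff_subset, hI, ?_⟩
      rw [h0, Finset.card_empty] at hc
      rw [h0]
      nlinarith
    rcases ih S' hne with ⟨u, hu, hstep⟩ | ⟨I, hIS, hI', hcard⟩
    · left
      obtain ⟨w, hw, hadj, hlt⟩ := (Finset.mem_filter.mp (hu 0 (by omega))).2
      refine ⟨fun k => if k = 0 then w else u (k - 1), ?_, ?_⟩
      · intro k hk
        by_cases h : k = 0
        · simpa [h] using hw
        · simpa [h] using hsub (hu (k - 1) (by omega))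
      · intro k hk
        by_cases h : k = 0
        · subst h
          simpa using ⟨hadj, hlt⟩
        · obtain ⟨d, rfl⟩ : ∃ d, k = d + 1 := ⟨k - 1, by omega⟩
          simpa using hstep d (by omega)
    · right
      rcases le_total I.card (S \ S').card with h | h
      · refine ⟨S \ S', Finset.sdiff_subset, hI, ?_⟩
        have := Nat.mul_le_mul_left t h
        rw [add_mul]
        omega
      · refine ⟨I, hIS.trans hsub, hI', ?_⟩
        rw [add_mul]
        omega

namespace SearchTree

variable {V : Type*} {G : SimpleGraph V} {r : ℕ} {root : V} (T : SearchTree G r root)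

/-- The vertices of a given level. -/
noncomputable def layer [Fintype V] (i : ℕ) : Finset V := Finset.univ.filter (fun u => T.lev u = i)

lemma mem_layer [Fintype V] {i : ℕ} {u : V} : u ∈ T.layer i ↔ T.lev u = i := by simp [layer]

lemma card_layer_zero [Fintype V] : (T.layer 0).card = 1 := by
  rw [Finset.card_eq_one]
  exact ⟨root, by ext u; simp [mem_layer, T.lev_eq_zero]⟩

/-- The first layers of a graph without a cycle of length `m` contain large independent sets. -/
lemma exists_indep_layer [Fintype V] {m i : ℕ} (hfree : (SimpleGraph.cycleGraph m).Free G)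
    (hi : i ≤ r) (him : 2 * i + 1 ≤ m) :
    ∃ I ⊆ T.layer i, G.IsIndepSet (I : Set V) ∧ (T.layer i).card ≤ m * I.card := by
  rcases (T.layer i).eq_empty_or_nonempty with h0 | hne
  · exact ⟨∅, by simp, by simp [SimpleGraph.IsIndepSet], by simp [h0]⟩
  set e : V → ℕ := fun u => (Fintype.equivFin V u).val with he
  have hei : Function.Injective e := fun x y h => (Fintype.equivFin V).injective (Fin.ext h)
  have heN : ∀ u, e u < Fintype.card V := fun u => (Fintype.equivFin V u).2
  have hkey := T.key_injective hei heN i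
  refine (exists_increasing_path_or_indep G (T.key _ e i) hkey m (T.layer i) hne).resolve_left ?_
  rintro ⟨u, hu, hstep⟩
  have hu' : ∀ k ≤ m, T.lev (u k) = i := fun k hk => T.mem_layer.mp (hu k hk)
  obtain ⟨j, hj1, hji, c, hc, hsplit⟩ := T.exists_split hei heN hi (by omega) u hu'
    (fun k hk => (hstep k hk).2)
  -- A window of `m - 2 * j` steps straddling the split; truncated subtraction starts it at `0` when
  -- the split is early. Its length is positive because `j ≤ i` and `2 * i + 1 ≤ m`.
  obtain ⟨x, hxc, hcx, hxm⟩ : ∃ x, x ≤ c ∧ c < x + (m - 2 * j) ∧ x + (m - 2 * j) ≤ m :=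
    ⟨c + 1 - (m - 2 * j), by omega, by omega, by omega⟩
  obtain ⟨h1, h2⟩ := hsplit x hxc _ hcx hxm
  have hmono : ∀ a b, a < b → b ≤ m → T.key (Fintype.card V) e i (u a) <
      T.key (Fintype.card V) e i (u b) := by
    intro a b hab
    induction b, hab using Nat.le_induction with
    | base => intro hb; exact (hstep a (by omega)).2
    | succ b _ ih => intro hb; exact (ih (by omega)).trans (hstep b (by omega)).2
  have := T.cycle_of_fork (s := m - 2 * j) (hu' x (by omega)) (hu' _ hxm) hi hj1 hji h1 h2
    (fun k => u (x + k)) rfl rfl (fun k hk => (hstep (x + k) (by omega)).1) ?_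
    (fun k hk => (hu' _ (by omega)).ge) (by omega)
  · rw [show m - 2 * j + 2 * j = m by omega] at this
    exact hfree this
  · intro a ha b hb hab
    simp only [Set.mem_Iic] at ha hb
    rcases lt_trichotomy a b with h | h | h
    · have := hmono (x + a) (x + b) (by omega) (by omega)
      simp only at hab
      rw [hab] at this
      exact absurd this (lt_irrefl _)
    · exact h
    · have := hmono (x + b) (x + a) (by omega) (by omega)
      simp only at hab
      rw [hab] at this
      exact absurd this (lt_irrefl _)

/-- In a graph without a cycle of length `2 l` there is a total order refining the levels for
which few edges go forward from a layer. -/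
lemma exists_order_card_forward_le [Fintype V] {l : ℕ}
    (hfree : (SimpleGraph.cycleGraph (2 * l)).Free G) (i : ℕ) (hi : i ≤ r) (hi1 : 1 ≤ i)
    (hil : i < l) :
    ∃ o : V → ℕ ×ₗ ℕ, Function.Injective o ∧ (∀ u w, T.lev u < T.lev w → o u < o w) ∧
      (Finset.univ.filter (fun e : V × V => T.lev e.1 = i ∧ T.lev e.2 ≤ i + 1 ∧ G.Adj e.1 e.2 ∧
        o e.1 < o e.2)).card ≤ l * (2 * (T.layer i).card + (T.layer (i + 1)).card) := by
  set e : V → ℕ := fun u => (Fintype.equivFin V u).val with he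
  have hei : Function.Injective e := fun x y h => (Fintype.equivFin V).injective (Fin.ext h)
  have heN : ∀ u, e u < Fintype.card V := fun u => (Fintype.equivFin V u).2
  have hkey := T.key_injective hei heN i
  -- Levels come first, so edges to layer `i + 1` go forward; ties inside layer `i` are broken by
  -- ancestry, as the splitting argument needs.
  set o : V → ℕ ×ₗ ℕ := fun u => toLex (T.lev u, T.key (Fintype.card V) e i u) with ho
  have hoi : Function.Injective o := fun x y h => by
    simp only [ho, EmbeddingLike.apply_eq_iff_eq, Prod.mk.injEq] at h
    exact hkey h.2
  refine ⟨o, hoi, fun u w h => by simp [ho, Prod.Lex.toLex_lt_toLex, h], ?_⟩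
  set E := Finset.univ.filter (fun e : V × V => T.lev e.1 = i ∧ T.lev e.2 ≤ i + 1 ∧
    G.Adj e.1 e.2 ∧ o e.1 < o e.2) with hE
  by_contra! hlt
  have hB : (T.layer i ∪ T.layer (i + 1)).card ≤ (T.layer i).card + (T.layer (i + 1)).card :=
    Finset.card_union_le _ _
  obtain ⟨z, hadj, hinj, hmem, hmono⟩ := exists_zigzag_path (G := G) o hoi (T.layer i)
    (T.layer i ∪ T.layer (i + 1)) l E (by
      intro e he
      simp only [hE, Finset.mem_filter, Finset.mem_univ, true_and] at he
      refine ⟨T.mem_layer.mpr he.1, ?_, he.2.2.1, he.2.2.2⟩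
      have h1 := he.2.2.2
      simp only [ho, Prod.Lex.toLex_lt_toLex] at h1
      rw [Finset.mem_union, T.mem_layer, T.mem_layer]
      omega) (lt_of_le_of_lt (Nat.mul_le_mul_left l (by omega)) hlt)
  have hu : ∀ k ≤ l, T.lev (z (2 * k)) = i := fun k hk => T.mem_layer.mp (hmem k hk).1
  have hlev : ∀ k ≤ 2 * l + 1, i ≤ T.lev (z k) := by
    intro k hk
    obtain ⟨c, rfl | rfl⟩ := Nat.even_or_odd' k
    · exact (hu c (by omega)).ge
    · have := (hmem c (by omega)).2
      rw [Finset.mem_union, T.mem_layer, T.mem_layer] at this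
      omega
  obtain ⟨j, hj1, hji, c, hc, hsplit⟩ := T.exists_split hei heN hi (t := l) (by omega)
    (fun k => z (2 * k)) hu (fun k hk => by
      have h1 := hmono k hk
      have h2 := hu k hk.le
      have h3 := hu (k + 1) hk
      rw [mul_add, mul_one] at h3 ⊢
      simp only [ho, Prod.Lex.toLex_lt_toLex, h2, h3, lt_irrefl, true_and, false_or] at h1
      exact h1)
  -- Only every second vertex of the zigzag is known to lie in layer `i`, so the segment has even
  -- length `2 * (l - j)`; this parity suits the cycle of length `2 * l`.
  obtain ⟨x, hxc, hcx, hxm⟩ : ∃ x, x ≤ c ∧ c < x + (l - j) ∧ x + (l - j) ≤ l :=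
    ⟨c + 1 - (l - j), by omega, by omega, by omega⟩
  obtain ⟨h1, h2⟩ := hsplit x hxc _ hcx hxm
  have := T.cycle_of_fork (s := 2 * (l - j)) (hu x (by omega)) (hu _ hxm) hi hj1 hji h1 h2
    (fun k => z (2 * x + k)) rfl (by simp [mul_add]) (fun k hk => hadj (2 * x + k) (by omega))
    (fun a ha b hb hab => by
      simp only [Set.mem_Iic] at ha hb
      have := hinj (show 2 * x + a ≤ _ by omega) (show 2 * x + b ≤ _ by omega) hab
      omega)
    (fun k hk => hlev _ (by omega)) (by omega)
  rw [show 2 * (l - j) + 2 * j = 2 * l by omega] at this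
  exact hfree this

end SearchTree

/-! ### Induced subgraphs and averaging. -/

/-- The graph induced on a finite set of vertices. -/
def restrict {V : Type*} (G : SimpleGraph V) (R : Finset V) : SimpleGraph R :=
  G.comap (Subtype.val : R → V)

lemma restrict_adj {V : Type*} {G : SimpleGraph V} {R : Finset V} {u v : R} :
    (restrict G R).Adj u v ↔ G.Adj u v := Iff.rfl

lemma free_restrict {V W : Type*} {H : SimpleGraph W} {G : SimpleGraph V} (h : H.Free G)
    (R : Finset V) : H.Free (restrict G R) := by
  rintro ⟨c⟩
  refine h ⟨⟨⟨fun x => (c x).val, fun {a b} hab => c.toHom.map_adj hab⟩, ?_⟩⟩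
  intro x y hxy
  exact c.injective (Subtype.ext hxy)

lemma card_neighbors_restrict {V : Type*} (G : SimpleGraph V) (R : Finset V) (v : R) :
    (Finset.univ.filter ((restrict G R).Adj v)).card = (R.filter (G.Adj v)).card := by
  refine Finset.card_bij (fun u _ => u.val) ?_ ?_ ?_
  · intro u hu
    simp only [Finset.mem_filter, Finset.mem_univ, true_and, restrict_adj] at hu
    exact Finset.mem_filter.mpr ⟨u.2, hu⟩
  · intro a _ b _ h
    exact Subtype.ext h
  · intro u hu
    rw [Finset.mem_filter] at hu
    exact ⟨⟨u, hu.1⟩, by simpa [restrict_adj] using hu.2, rfl⟩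

lemma exists_indep_of_restrict {V : Type*} {G : SimpleGraph V} {R : Finset V} {I : Finset R}
    (hI : (restrict G R).IsIndepSet (I : Set R)) :
    I.map (Function.Embedding.subtype _) ⊆ R ∧
      G.IsIndepSet (I.map (Function.Embedding.subtype _) : Set V) ∧
      (I.map (Function.Embedding.subtype (· ∈ R))).card = I.card := by
  refine ⟨?_, ?_, Finset.card_map _⟩
  · intro x hx
    obtain ⟨y, -, rfl⟩ := Finset.mem_map.mp hx
    exact y.2
  · intro x hx y hy hxy
    obtain ⟨x', hx', rfl⟩ := Finset.mem_map.mp (Finset.mem_coe.mp hx)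
    obtain ⟨y', hy', rfl⟩ := Finset.mem_map.mp (Finset.mem_coe.mp hy)
    exact hI hx' hy' (fun h => hxy (by rw [h]))

/-- At least half of the terms are at most twice the average. -/
lemma card_le_two_mul_card_filter_le {V : Type*} (S : Finset V) (f : V → ℝ) (hf : ∀ v, 0 ≤ f v)
    {c : ℝ} (hc : 0 < c) (h : ∑ v ∈ S, f v ≤ c * S.card) :
    S.card ≤ 2 * (S.filter (fun v => f v ≤ 2 * c)).card := by
  have h1 : ((S.filter (fun v => ¬ f v ≤ 2 * c)).card : ℝ) * (2 * c) ≤ c * S.card := by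
    refine le_trans ?_ h
    rw [← nsmul_eq_mul]
    refine le_trans (Finset.card_nsmul_le_sum _ f _ fun v hv => ?_)
      (Finset.sum_le_sum_of_subset_of_nonneg (Finset.filter_subset _ _) fun v _ _ => hf v)
    exact (not_le.mp (Finset.mem_filter.mp hv).2).le
  have h2 : (2 * (S.filter (fun v => ¬ f v ≤ 2 * c)).card : ℝ) ≤ S.card := by
    refine le_of_mul_le_mul_right ?_ hc
    linarith
  have h3 := Finset.card_filter_add_card_filter_not (s := S) (fun v => f v ≤ 2 * c)
  have h4 : 2 * (S.filter (fun v => ¬ f v ≤ 2 * c)).card ≤ S.card := by exact_mod_cast h2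
  omega

/-- A graph all of whose induced subgraphs have a vertex of degree at most `D` has average degree
at most `2 D`. -/
lemma sum_degree_le_of_degenerate {V : Type*} (G : SimpleGraph V) (D : ℝ)
    (h : ∀ R : Finset V, R.Nonempty → ∃ v ∈ R, ((R.filter (G.Adj v)).card : ℝ) ≤ D) :
    ∀ R : Finset V, ∑ v ∈ R, ((R.filter (G.Adj v)).card : ℝ) ≤ 2 * D * R.card := by
  intro R
  induction R using Finset.strongInduction with
  | H R ih =>
    rcases R.eq_empty_or_nonempty with rfl | hne
    · simp
    obtain ⟨v, hv, hD⟩ := h R hne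
    have ih' := ih _ (Finset.erase_ssubset hv)
    set R' := R.erase v with hR'
    have hvR' : v ∉ R' := Finset.notMem_erase v R
    have hR : R = insert v R' := (Finset.insert_erase hv).symm
    have hcard : (R.card : ℝ) = R'.card + 1 := by
      rw [hR, Finset.card_insert_of_notMem hvR']
      push_cast
      ring
    have hdeg : (R.filter (G.Adj v)).card = (R'.filter (G.Adj v)).card := by
      rw [hR, Finset.filter_insert, if_neg (G.loopless.irrefl v)]
    have hu : ∀ u ∈ R', ((R.filter (G.Adj u)).card : ℝ) =
        (R'.filter (G.Adj u)).card + if G.Adj v u then 1 else 0 := by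
      intro u _
      rw [hR, Finset.filter_insert]
      by_cases huv : G.Adj v u
      · rw [if_pos huv.symm, Finset.card_insert_of_notMem (by simp [hvR']), if_pos huv]
        push_cast
        ring
      · rw [if_neg (fun h => huv h.symm), if_neg huv, add_zero]
    have hsum : ∑ u ∈ R', (if G.Adj v u then (1 : ℝ) else 0) = (R'.filter (G.Adj v)).card := by
      simp
    have hs : ∑ u ∈ R, ((R.filter (G.Adj u)).card : ℝ) =
        (R.filter (G.Adj v)).card + ∑ u ∈ R', ((R.filter (G.Adj u)).card : ℝ) := by
      conv_lhs => rw [← Finset.add_sum_erase R _ hv]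
    rw [hs, Finset.sum_congr rfl hu, Finset.sum_add_distrib, hsum, hcard, ← hdeg]
    nlinarith

/-! ### Degree bounds for graphs without an even cycle. -/

namespace SearchTree

variable {V : Type*} {G : SimpleGraph V} {root : V}

lemma card_edges_between_layers_le [Fintype V] {l : ℕ} (T : SearchTree G l root)
    (hfree : (SimpleGraph.cycleGraph (2 * l)).Free G) (i : ℕ) (hil : i < l) :
    (Finset.univ.filter (fun e : V × V => T.lev e.1 = i ∧ T.lev e.2 = i + 1 ∧
      G.Adj e.1 e.2)).card ≤ l * (2 * (T.layer i).card + (T.layer (i + 1)).card) := by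
  rcases Nat.eq_zero_or_pos i with rfl | hi
  · have hsub : Finset.univ.filter (fun e : V × V => T.lev e.1 = 0 ∧ T.lev e.2 = 0 + 1 ∧
        G.Adj e.1 e.2) ⊆ T.layer 0 ×ˢ T.layer (0 + 1) := by
      intro e he
      simp only [Finset.mem_filter, Finset.mem_univ, true_and] at he
      rw [Finset.mem_product, T.mem_layer, T.mem_layer]
      exact ⟨he.1, he.2.1⟩
    have := Finset.card_le_card hsub
    rw [Finset.card_product, T.card_layer_zero] at this
    nlinarith
  · obtain ⟨o, -, ho, hE⟩ := T.exists_order_card_forward_le hfree i hil.le hi hil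
    refine le_trans (Finset.card_le_card ?_) hE
    intro e he
    simp only [Finset.mem_filter, Finset.mem_univ, true_and] at he ⊢
    exact ⟨he.1, he.2.1.le, he.2.2, ho _ _ (by omega)⟩

/-- Each edge at layer `i + 1` goes down to layer `i` or is a forward edge from layer `i + 1` in one
of its two directions. Edges inside the layer contribute to two degrees, hence the factor `2`. -/
lemma sum_degree_layer_le [Fintype V] {l : ℕ} (T : SearchTree G l root)
    (hfree : (SimpleGraph.cycleGraph (2 * l)).Free G) (i : ℕ) (hil : i + 1 < l) :
    ∑ u ∈ T.layer (i + 1), (Finset.univ.filter (G.Adj u)).card ≤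
      l * (2 * (T.layer i).card + (T.layer (i + 1)).card) +
        2 * (l * (2 * (T.layer (i + 1)).card + (T.layer (i + 1 + 1)).card)) := by
  have hB := T.card_edges_between_layers_le hfree i (by omega)
  obtain ⟨o, hoi, ho, hF⟩ := T.exists_order_card_forward_le hfree (i + 1) hil.le (by omega) hil
  set B := Finset.univ.filter (fun e : V × V => T.lev e.1 = i ∧ T.lev e.2 = i + 1 ∧ G.Adj e.1 e.2)
  set F := Finset.univ.filter (fun e : V × V => T.lev e.1 = i + 1 ∧ T.lev e.2 ≤ i + 1 + 1 ∧
    G.Adj e.1 e.2 ∧ o e.1 < o e.2)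
  have hsum : ∑ u ∈ T.layer (i + 1), (Finset.univ.filter (G.Adj u)).card =
      ((T.layer (i + 1) ×ˢ Finset.univ).filter (fun e : V × V => G.Adj e.1 e.2)).card := by
    simp_rw [Finset.card_filter]
    rw [Finset.sum_product]
  have hsub : (T.layer (i + 1) ×ˢ Finset.univ).filter (fun e : V × V => G.Adj e.1 e.2) ⊆
      B.image Prod.swap ∪ (F ∪ F.image Prod.swap) := by
    rintro ⟨u, w⟩ he
    simp only [Finset.mem_filter, Finset.mem_product, T.mem_layer, Finset.mem_univ, and_true] at he
    obtain ⟨hu, hadj⟩ := he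
    have h1 := T.lev_adj u w hadj (by omega)
    have h2 : i ≤ T.lev w := by
      by_contra! h
      have := T.lev_adj w u hadj.symm (by omega)
      omega
    have himg : ∀ (A : Finset (V × V)), (w, u) ∈ A → (u, w) ∈ A.image Prod.swap :=
      fun A h => Finset.mem_image.mpr ⟨(w, u), h, rfl⟩
    rw [Finset.mem_union, Finset.mem_union]
    rcases Nat.eq_or_lt_of_le h2 with h | h
    · left
      apply himg
      simp only [B, Finset.mem_filter, Finset.mem_univ, true_and]
      exact ⟨h.symm, hu, hadj.symm⟩
    right
    rcases lt_trichotomy (o u) (o w) with h' | h' | h'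
    · left
      simp only [F, Finset.mem_filter, Finset.mem_univ, true_and]
      exact ⟨hu, by omega, hadj, h'⟩
    · exact absurd (hoi h') hadj.ne
    · right
      apply himg
      simp only [F, Finset.mem_filter, Finset.mem_univ, true_and]
      refine ⟨?_, by omega, hadj.symm, h'⟩
      by_contra hw
      have := ho u w (by omega)
      exact absurd (this.trans h') (lt_irrefl _)
  have c1 := Finset.card_le_card hsub
  have c2 := Finset.card_union_le (B.image Prod.swap) (F ∪ F.image Prod.swap)
  have c3 := Finset.card_union_le F (F.image Prod.swap)
  have c4 : (B.image Prod.swap).card ≤ B.card := Finset.card_image_le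
  have c5 : (F.image Prod.swap).card ≤ F.card := Finset.card_image_le
  rw [hsum]
  omega

end SearchTree

/-- The minimum degree form of the Bondy–Simonovits theorem. -/
lemma exists_degree_le_of_evenCycle_free {V : Type*} [Fintype V] [Nonempty V] {G : SimpleGraph V}
    {l : ℕ} (hl : 2 ≤ l) (hfree : (SimpleGraph.cycleGraph (2 * l)).Free G) :
    ∃ v, ((Finset.univ.filter (G.Adj v)).card : ℝ) ≤
      14 * l * (Fintype.card V : ℝ) ^ ((1 : ℝ) / l) := by
  by_contra! hdeg
  obtain ⟨root⟩ := ‹Nonempty V›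
  obtain ⟨T⟩ := exists_searchTree G l root
  have hlR : (2 : ℝ) ≤ l := by exact_mod_cast hl
  have hn1 : (1 : ℝ) ≤ Fintype.card V := by exact_mod_cast Fintype.card_pos_iff.mpr ⟨root⟩
  set q : ℝ := (Fintype.card V : ℝ) ^ ((1 : ℝ) / l) with hq
  have hq1 : 1 ≤ q := Real.one_le_rpow hn1 (by positivity)
  -- For consecutive layer sizes `a ≤ b` and `c`, the degree sum gives `14 q b ≤ 7 b + 2 c`, so `c >
  -- (3 / 2) q b` since `q ≥ 1`. The surplus factor `3 / 2` makes layer `l` exceed `q ^ l = n`.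
  have hgrow : ∀ i < l, ((T.layer i).card : ℝ) ≤ (T.layer (i + 1)).card ∧
      (3 / 2 * q) * (T.layer i).card < (T.layer (i + 1)).card := by
    intro i
    induction i with
    | zero =>
      intro _
      have hsub : Finset.univ.filter (G.Adj root) ⊆ T.layer (0 + 1) := by
        intro u hu
        simp only [Finset.mem_filter, Finset.mem_univ, true_and] at hu
        have h0 := (T.lev_eq_zero root).mpr rfl
        have h1 := T.lev_adj root u hu (by omega)
        have h2 : T.lev u ≠ 0 := fun h => hu.ne ((T.lev_eq_zero u).mp h).symm
        rw [T.mem_layer]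
        omega
      have h1 : ((Finset.univ.filter (G.Adj root)).card : ℝ) ≤ (T.layer (0 + 1)).card := by
        exact_mod_cast Finset.card_le_card hsub
      have h2 := hdeg root
      rw [T.card_layer_zero]
      have h3 : 28 * q ≤ 14 * l * q := by nlinarith
      constructor <;> push_cast <;> nlinarith
    | succ i ih =>
      intro hi
      obtain ⟨h1, h2⟩ := ih (by omega)
      have hsum := T.sum_degree_layer_le hfree i hi
      have hsum' : (∑ u ∈ T.layer (i + 1), ((Finset.univ.filter (G.Adj u)).card : ℝ)) ≤
          l * (2 * (T.layer i).card + (T.layer (i + 1)).card) +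
            2 * (l * (2 * (T.layer (i + 1)).card + (T.layer (i + 1 + 1)).card)) := by
        exact_mod_cast hsum
      have hlow : (T.layer (i + 1)).card * (14 * l * q) ≤
          ∑ u ∈ T.layer (i + 1), ((Finset.univ.filter (G.Adj u)).card : ℝ) := by
        rw [← nsmul_eq_mul]
        exact Finset.card_nsmul_le_sum _ _ _ fun u _ => (hdeg u).le
      set a : ℝ := ((T.layer i).card : ℝ)
      set b : ℝ := ((T.layer (i + 1)).card : ℝ)
      have hb : 0 < b := lt_of_le_of_lt (by positivity) h2
      have key : (l : ℝ) * (14 * q * b) ≤ l * (7 * b + 2 * (T.layer (i + 1 + 1)).card) := by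
        have : (l : ℝ) * a ≤ l * b := mul_le_mul_of_nonneg_left h1 (by positivity)
        nlinarith
      have key' := le_of_mul_le_mul_left key (by linarith)
      constructor <;> nlinarith
  have hpow : ∀ i ≤ l, (3 / 2 * q) ^ i ≤ ((T.layer i).card : ℝ) := by
    intro i
    induction i with
    | zero => intro _; simp [T.card_layer_zero]
    | succ i ih =>
      intro hi
      rw [pow_succ']
      exact (mul_le_mul_of_nonneg_left (ih (by omega)) (by positivity)).trans
        (hgrow i (by omega)).2.le
  have h1 := hpow l le_rfl
  have h2 : ((T.layer l).card : ℝ) ≤ Fintype.card V := by exact_mod_cast Finset.card_le_univ _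
  have h3 : q ^ l = Fintype.card V := by
    rw [hq, one_div, Real.rpow_inv_natCast_pow (by positivity) (by omega)]
  rw [mul_pow, h3] at h1
  have h4 : (1 : ℝ) < (3 / 2) ^ l := one_lt_pow₀ (by norm_num) (by omega)
  nlinarith

/-- Half of the vertices of a graph without a cycle of length `2 l` induce a graph of small
maximum degree. -/
lemma exists_half_degree_le_of_evenCycle_free {V : Type*} [Fintype V] {G : SimpleGraph V}
    {l : ℕ} (hl : 2 ≤ l) (hfree : (SimpleGraph.cycleGraph (2 * l)).Free G) :
    ∃ S : Finset V, Fintype.card V ≤ 2 * S.card ∧ ∀ v ∈ S, ((S.filter (G.Adj v)).card : ℝ) ≤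
      56 * l * (Fintype.card V : ℝ) ^ ((1 : ℝ) / l) := by
  rcases isEmpty_or_nonempty V with hV | hV
  · exact ⟨∅, by simp, by simp⟩
  have hlR : (2 : ℝ) ≤ l := by exact_mod_cast hl
  have hn1 : (0 : ℝ) < Fintype.card V := by exact_mod_cast Fintype.card_pos
  set D : ℝ := 14 * l * (Fintype.card V : ℝ) ^ ((1 : ℝ) / l) with hD
  have hD0 : 0 < D := by positivity
  have hsum := sum_degree_le_of_degenerate G D (fun R hR => by
    have : Nonempty R := hR.to_subtype
    obtain ⟨v, hv⟩ := exists_degree_le_of_evenCycle_free hl (free_restrict hfree R)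
    refine ⟨v, v.2, ?_⟩
    rw [card_neighbors_restrict, Fintype.card_coe] at hv
    refine hv.trans ?_
    have : (R.card : ℝ) ≤ Fintype.card V := by exact_mod_cast Finset.card_le_univ R
    rw [hD]
    gcongr) Finset.univ
  -- The average degree is at most `2 * D`, so half of the vertices have degree at most `4 * D`,
  -- which explains the constant `56 = 4 * 14`.
  have hhalf := card_le_two_mul_card_filter_le Finset.univ _ (fun v => by positivity)
    (by positivity : 0 < 2 * D) hsum
  refine ⟨_, hhalf, fun v hv => ?_⟩
  have h1 := (Finset.mem_filter.mp hv).2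
  have h2 : ((Finset.filter (G.Adj v) (Finset.univ.filter
      (fun v => ((Finset.univ.filter (G.Adj v)).card : ℝ) ≤ 2 * (2 * D)))).card : ℝ) ≤
      (Finset.univ.filter (G.Adj v)).card := by
    exact_mod_cast Finset.card_le_card (Finset.filter_subset_filter _ (Finset.subset_univ _))
  rw [hD] at h1
  linarith

/-! ### Random independent sets in locally sparse graphs. -/

/-- The independent subsets of a finite set of vertices. -/
noncomputable def indepSubsets {V : Type*} (G : SimpleGraph V) (X : Finset V) :
    Finset (Finset V) := X.powerset.filter (fun T => G.IsIndepSet (T : Set V))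

lemma mem_indepSubsets {V : Type*} {G : SimpleGraph V} {X T : Finset V} :
    T ∈ indepSubsets G X ↔ T ⊆ X ∧ G.IsIndepSet (T : Set V) := by
  simp [indepSubsets]

lemma empty_mem_indepSubsets {V : Type*} (G : SimpleGraph V) (X : Finset V) :
    ∅ ∈ indepSubsets G X := by
  simp [mem_indepSubsets, SimpleGraph.IsIndepSet]

/-- Replacing the part of an independent set in the closed neighbourhood of `u` by `u` alone keeps
it independent, and remembering the erased part makes the map injective. So a vertex of bounded
degree lies in a positive proportion of the independent sets. -/
lemma card_indepSubsets_le_mul {V : Type*} (G : SimpleGraph V) (X : Finset V) {u : V}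
    (hu : u ∈ X) : (indepSubsets G X).card ≤
      ((indepSubsets G X).filter (u ∈ ·)).card * 2 ^ ((X.filter (G.Adj u)).card + 1) := by
  set N := insert u (X.filter (G.Adj u)) with hN
  have hNc : N.powerset.card ≤ 2 ^ ((X.filter (G.Adj u)).card + 1) := by
    rw [Finset.card_powerset]
    exact Nat.pow_le_pow_right (by norm_num) (Finset.card_insert_le _ _)
  refine le_trans ?_ (Nat.mul_le_mul_left _ hNc)
  rw [← Finset.card_product]
  refine Finset.card_le_card_of_injOn (fun T => (insert u (T \ N), T ∩ N)) ?_ ?_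
  · intro T hT
    obtain ⟨hTX, hTi⟩ := mem_indepSubsets.mp (Finset.mem_coe.mp hT)
    simp only [Finset.coe_product, Set.mem_prod, Finset.mem_coe, Finset.mem_filter,
      mem_indepSubsets, Finset.mem_powerset]
    refine ⟨⟨⟨?_, ?_⟩, Finset.mem_insert_self _ _⟩, Finset.inter_subset_right⟩
    · exact Finset.insert_subset hu (Finset.sdiff_subset.trans hTX)
    · have hnon : ∀ w ∈ T \ N, ¬ G.Adj u w := fun w hw hadj => by
        rw [Finset.mem_sdiff, hN, Finset.mem_insert, Finset.mem_filter] at hw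
        exact hw.2 (Or.inr ⟨hTX hw.1, hadj⟩)
      intro x hx y hy hxy
      rw [Finset.mem_coe, Finset.mem_insert] at hx hy
      rcases hx with rfl | hx <;> rcases hy with rfl | hy
      · exact absurd rfl hxy
      · exact hnon y hy
      · exact fun h => hnon x hx h.symm
      · exact hTi (Finset.mem_sdiff.mp hx).1 (Finset.mem_sdiff.mp hy).1 hxy
  · intro T hT T' hT' h
    simp only [Prod.mk.injEq] at h
    have huN : u ∈ N := Finset.mem_insert_self _ _
    ext w
    by_cases hw : w ∈ N
    · have := Finset.ext_iff.mp h.2 w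
      simpa [hw] using this
    · have hwu : w ≠ u := fun hh => hw (hh ▸ huN)
      have := Finset.ext_iff.mp h.1 w
      simpa [hw, hwu] using this

/-- In a sparse graph the average size of an independent set is linear in the number of
vertices. -/
lemma card_mul_card_indepSubsets_le {V : Type*} (G : SimpleGraph V) (X : Finset V) {K : ℕ}
    (hK : 0 < K) (h : ∑ u ∈ X, (X.filter (G.Adj u)).card ≤ K * X.card) :
    X.card * (indepSubsets G X).card ≤
      2 ^ (2 * K + 2) * ∑ T ∈ indepSubsets G X, T.card := by
  have hsum : ∑ T ∈ indepSubsets G X, T.card =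
      ∑ u ∈ X, ((indepSubsets G X).filter (u ∈ ·)).card := by
    simp_rw [Finset.card_filter]
    rw [Finset.sum_comm]
    refine Finset.sum_congr rfl fun T hT => ?_
    rw [← Finset.card_filter, Finset.filter_mem_eq_inter,
      Finset.inter_eq_right.mpr (mem_indepSubsets.mp hT).1]
  have hhalf := card_le_two_mul_card_filter_le X (fun u => ((X.filter (G.Adj u)).card : ℝ))
    (fun u => by positivity) (c := K) (by exact_mod_cast hK) (by exact_mod_cast h)
  set Y := X.filter (fun u => ((X.filter (G.Adj u)).card : ℝ) ≤ 2 * K) with hY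
  have hYle : Y.card * (indepSubsets G X).card ≤
      2 ^ (2 * K + 1) * ∑ u ∈ X, ((indepSubsets G X).filter (u ∈ ·)).card := by
    rw [Finset.mul_sum, ← smul_eq_mul]
    refine le_trans (Finset.card_nsmul_le_sum Y (fun u => 2 ^ (2 * K + 1) *
      ((indepSubsets G X).filter (u ∈ ·)).card) _ fun u hu => ?_)
      (Finset.sum_le_sum_of_subset (Finset.filter_subset _ _))
    obtain ⟨huX, hud⟩ := Finset.mem_filter.mp hu
    have hud' : (X.filter (G.Adj u)).card ≤ 2 * K := by exact_mod_cast hud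
    refine (card_indepSubsets_le_mul G X huX).trans ?_
    rw [mul_comm]
    exact Nat.mul_le_mul_right _ (Nat.pow_le_pow_right (by norm_num) (by omega))
  rw [hsum, show 2 * K + 2 = (2 * K + 1) + 1 by ring, pow_succ]
  nlinarith [Nat.mul_le_mul_right (indepSubsets G X).card hhalf]

/-- The independent sets that agree outside the closed neighbourhood of `v` and avoid `v`
correspond to the independent sets of the part of the neighbourhood that is not blocked. -/
lemma sum_fiber_avoiding {V : Type*} [Fintype V] (G : SimpleGraph V) (v : V) (J : Finset V)
    (hJ : G.IsIndepSet (J : Set V)) (hJv : ∀ u ∈ J, u ≠ v ∧ ¬ G.Adj v u) (h : Finset V → ℝ) :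
    ∑ I ∈ (indepSubsets G Finset.univ).filter
        (fun I => I.filter (fun u => u ≠ v ∧ ¬ G.Adj v u) = J ∧ v ∉ I), h (I.filter (G.Adj v)) =
      ∑ T ∈ indepSubsets G (Finset.univ.filter (fun u => G.Adj v u ∧ ∀ w ∈ J, ¬ G.Adj u w)),
        h T := by
  refine Finset.sum_nbij' (fun I => I.filter (G.Adj v)) (fun T => J ∪ T) ?_ ?_ ?_ ?_
    (fun _ _ => rfl)
  · intro I hI
    simp only [Finset.mem_filter, mem_indepSubsets] at hI
    obtain ⟨⟨-, hind⟩, rfl, -⟩ := hI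
    refine mem_indepSubsets.mpr ⟨fun u hu => ?_, fun x hx y hy => ?_⟩
    · obtain ⟨hu, hadj⟩ := Finset.mem_filter.mp hu
      refine Finset.mem_filter.mpr ⟨Finset.mem_univ _, hadj, fun w hw hadj' => ?_⟩
      exact hind hu (Finset.mem_filter.mp hw).1 hadj'.ne hadj'
    · exact hind (Finset.mem_filter.mp hx).1 (Finset.mem_filter.mp hy).1
  · intro T hT
    obtain ⟨hTX, hTi⟩ := mem_indepSubsets.mp hT
    have hT' : ∀ u ∈ T, G.Adj v u ∧ ∀ w ∈ J, ¬ G.Adj u w := fun u hu =>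
      (Finset.mem_filter.mp (hTX hu)).2
    simp only [Finset.mem_filter, mem_indepSubsets]
    refine ⟨⟨Finset.subset_univ _, ?_⟩, ?_, ?_⟩
    · intro x hx y hy hxy
      rw [Finset.mem_coe, Finset.mem_union] at hx hy
      rcases hx with hx | hx <;> rcases hy with hy | hy
      · exact hJ hx hy hxy
      · exact fun hh => (hT' y hy).2 x hx hh.symm
      · exact (hT' x hx).2 y hy
      · exact hTi hx hy hxy
    · ext u
      simp only [Finset.mem_filter, Finset.mem_union]
      constructor
      · rintro ⟨hu | hu, -, h2⟩
        · exact hu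
        · exact absurd (hT' u hu).1 h2
      · exact fun hu => ⟨Or.inl hu, hJv u hu⟩
    · rw [Finset.mem_union]
      rintro (hv | hv)
      · exact (hJv v hv).1 rfl
      · exact (hT' v hv).1.ne rfl
  · intro I hI
    simp only [Finset.mem_filter, mem_indepSubsets] at hI
    obtain ⟨-, rfl, hv⟩ := hI
    ext u
    simp only [Finset.mem_union, Finset.mem_filter]
    constructor
    · rintro (⟨hu, -⟩ | ⟨hu, -⟩) <;> exact hu
    · intro hu
      have : u ≠ v := fun hh => hv (hh ▸ hu)
      tauto
  · intro T hT
    obtain ⟨hTX, hTi⟩ := mem_indepSubsets.mp hT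
    have hT' : ∀ u ∈ T, G.Adj v u := fun u hu => (Finset.mem_filter.mp (hTX hu)).2.1
    ext u
    simp only [Finset.mem_union, Finset.mem_filter]
    constructor
    · rintro ⟨hu | hu, h2⟩
      · exact absurd h2 (hJv u hu).2
      · exact hu
    · exact fun hu => ⟨Or.inr hu, hT' u hu⟩

/-- Balances the two sources of weight on a fibre with `1 + N` independent sets: if `N ≤ √d`, the
single set containing `v` contributes enough through `d`; if `N > √d`, then `x ≥ log N ≥ (log d) /
2` and the neighbours contribute enough through `s`. -/
lemma log_mul_card_fiber_le {d x N s c : ℝ} (hd : 1 ≤ d) (hc0 : 0 ≤ c) (hc1 : c ≤ 1)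
    (hN : 1 ≤ N) (hNx : Real.log N ≤ x) (hs : c * (x * N) ≤ s) (hs0 : 0 ≤ s) :
    c / 4 * Real.log d * (1 + N) ≤ d + s := by
  have hlog0 : 0 ≤ Real.log d := Real.log_nonneg hd
  have hsq : Real.sqrt d * Real.sqrt d = d := Real.mul_self_sqrt (by linarith)
  have hsq1 : 1 ≤ Real.sqrt d := Real.one_le_sqrt.mpr hd
  have hlogs : Real.log d = 2 * Real.log (Real.sqrt d) := by
    rw [Real.log_sqrt (by linarith)]; ring
  have h1 : c / 4 * Real.log d * (1 + N) ≤ c / 2 * (Real.log d * N) := by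
    have : 0 ≤ c / 4 * Real.log d := by positivity
    nlinarith
  refine h1.trans ?_
  rcases le_or_gt N (Real.sqrt d) with hle | hlt
  · have h2 : Real.log d ≤ 2 * Real.sqrt d := by
      have := Real.log_le_sub_one_of_pos (show 0 < Real.sqrt d by linarith)
      linarith
    have h3 : Real.log d * N ≤ 2 * Real.sqrt d * Real.sqrt d :=
      mul_le_mul h2 hle (by linarith) (by linarith)
    have h4 : c / 2 * (Real.log d * N) ≤ 1 / 2 * (2 * Real.sqrt d * Real.sqrt d) :=
      mul_le_mul (by linarith) h3 (by positivity) (by norm_num)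
    nlinarith
  · have h2 : Real.log d / 2 ≤ x := by
      have := Real.log_le_log (by linarith) hlt.le
      linarith
    have h3 : c * (Real.log d / 2 * N) ≤ c * (x * N) :=
      mul_le_mul_of_nonneg_left (mul_le_mul_of_nonneg_right h2 (by linarith)) hc0
    linarith

/-- On average over all independent sets `I`, the closed neighbourhood of every vertex `v` carries
weight of order `log d`, where `v` has weight `d` and its neighbours have weight `1`. -/
lemma log_mul_card_le_sum_weight {V : Type*} [Fintype V] (G : SimpleGraph V) {K : ℕ}
    (hK : 0 < K) (v : V) (hsparse : ∀ S : Finset V, (∀ u ∈ S, G.Adj v u) →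
      ∑ u ∈ S, (S.filter (G.Adj u)).card ≤ K * S.card) {d : ℝ} (hd : 1 ≤ d) :
    1 / 2 ^ (2 * K + 2) / 4 * Real.log d * (indepSubsets G Finset.univ).card ≤
      ∑ I ∈ indepSubsets G Finset.univ,
        ((if v ∈ I then d else 0) + ((I.filter (G.Adj v)).card : ℝ)) := by
  set c : ℝ := 1 / 2 ^ (2 * K + 2) with hc
  have hc0 : 0 < c := by positivity
  have hc1 : c ≤ 1 := by
    rw [hc, div_le_one (by positivity)]
    exact one_le_pow₀ (by norm_num)
  set F := indepSubsets G Finset.univ with hF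
  -- Conditioning on the part `J` of `I` outside the closed neighbourhood of `v`: the rest of `I` is
  -- either `{v}` or any independent subset of the unblocked neighbours `X`.
  set p : Finset V → Finset V := fun I => I.filter (fun u => u ≠ v ∧ ¬ G.Adj v u) with hp
  have hmaps : ∀ I ∈ F, p I ∈ F.image p := fun I hI => Finset.mem_image_of_mem p hI
  rw [← Finset.sum_fiberwise_of_maps_to hmaps, Finset.card_eq_sum_card_fiberwise hmaps]
  push_cast
  rw [Finset.mul_sum]
  refine Finset.sum_le_sum fun J hJ => ?_
  obtain ⟨I₀, hI₀, rfl⟩ := Finset.mem_image.mp hJ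
  set J := p I₀ with hJdef
  have hJi : G.IsIndepSet (J : Set V) := fun x hx y hy =>
    (mem_indepSubsets.mp hI₀).2 (Finset.mem_filter.mp hx).1 (Finset.mem_filter.mp hy).1
  have hJv : ∀ u ∈ J, u ≠ v ∧ ¬ G.Adj v u := fun u hu => (Finset.mem_filter.mp hu).2
  set X := Finset.univ.filter (fun u => G.Adj v u ∧ ∀ w ∈ J, ¬ G.Adj u w) with hX
  have hfib := sum_fiber_avoiding G v J hJi hJv
  set Φ := F.filter (fun I => p I = J) with hΦ
  have hΦv : Φ.filter (v ∈ ·) = {insert v J} := by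
    ext I
    simp only [hΦ, hF, Finset.mem_filter, mem_indepSubsets, Finset.mem_singleton]
    constructor
    · rintro ⟨⟨⟨-, hind⟩, hIJ⟩, hv⟩
      rw [← hIJ]
      ext u
      simp only [hp, Finset.mem_insert, Finset.mem_filter]
      constructor
      · intro hu
        by_cases huv : u = v
        · exact Or.inl huv
        · exact Or.inr ⟨hu, huv, hind hv hu (Ne.symm huv)⟩
      · rintro (rfl | h)
        · exact hv
        · exact h.1
    · rintro rfl
      refine ⟨⟨⟨Finset.subset_univ _, ?_⟩, ?_⟩, Finset.mem_insert_self _ _⟩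
      · intro x hx y hy hxy
        rw [Finset.mem_coe, Finset.mem_insert] at hx hy
        rcases hx with rfl | hx <;> rcases hy with rfl | hy
        · exact absurd rfl hxy
        · exact (hJv y hy).2
        · exact fun h => (hJv x hx).2 h.symm
        · exact hJi hx hy hxy
      · ext u
        simp only [hp, Finset.mem_filter, Finset.mem_insert]
        constructor
        · rintro ⟨rfl | h, h1, -⟩
          · exact absurd rfl h1
          · exact h
        · exact fun hu => ⟨Or.inr hu, hJv u hu⟩
  have hΦn : Φ.filter (v ∉ ·) = F.filter (fun I => p I = J ∧ v ∉ I) := by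
    rw [hΦ, Finset.filter_filter]
  have hcard : (Φ.card : ℝ) = 1 + (indepSubsets G X).card := by
    have h1 := Finset.card_filter_add_card_filter_not (s := Φ) (v ∈ ·)
    have h2 := hfib (fun _ => 1)
    simp only [Finset.sum_const, nsmul_eq_mul, mul_one] at h2
    rw [hΦv, hΦn, Finset.card_singleton] at h1
    rw [← h1, ← h2]
    push_cast
    rfl
  have hsum : d + ∑ T ∈ indepSubsets G X, (T.card : ℝ) ≤
      ∑ I ∈ Φ, ((if v ∈ I then d else 0) + ((I.filter (G.Adj v)).card : ℝ)) := by
    rw [← Finset.sum_filter_add_sum_filter_not Φ (v ∈ ·), hΦv, Finset.sum_singleton,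
      if_pos (Finset.mem_insert_self _ _), hΦn]
    have h2 := hfib (fun T => T.card)
    rw [← h2]
    refine add_le_add (le_add_of_nonneg_right (by positivity)) ?_
    refine Finset.sum_le_sum fun I hI => ?_
    rw [if_neg (Finset.mem_filter.mp hI).2.2, zero_add]
  refine le_trans ?_ hsum
  rw [hcard]
  have hN1 : 1 ≤ (indepSubsets G X).card :=
    Finset.card_pos.mpr ⟨∅, empty_mem_indepSubsets G X⟩
  refine log_mul_card_fiber_le (x := X.card) hd hc0.le hc1 (by exact_mod_cast hN1) ?_ ?_
    (Finset.sum_nonneg fun T _ => Nat.cast_nonneg T.card)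
  · have hle : ((indepSubsets G X).card : ℝ) ≤ 2 ^ X.card := by
      have : (indepSubsets G X).card ≤ X.powerset.card :=
        Finset.card_le_card (Finset.filter_subset _ _)
      rw [Finset.card_powerset] at this
      exact_mod_cast this
    have h1 := Real.log_le_log (by exact_mod_cast hN1) hle
    rw [Real.log_pow] at h1
    have h2 : Real.log 2 ≤ 1 := by
      have := Real.log_two_lt_d9
      linarith
    nlinarith [(Nat.cast_nonneg X.card : (0 : ℝ) ≤ X.card)]
  · have h1 := card_mul_card_indepSubsets_le G X hK
      (hsparse X fun u hu => (Finset.mem_filter.mp hu).2.1)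
    have h2 : (X.card : ℝ) * (indepSubsets G X).card ≤
        2 ^ (2 * K + 2) * ∑ T ∈ indepSubsets G X, (T.card : ℝ) := by exact_mod_cast h1
    rw [hc, one_div, inv_mul_le_iff₀ (by positivity)]
    exact h2

lemma sum_weight_le {V : Type*} [Fintype V] (G : SimpleGraph V) {d : ℝ}
    (hdeg : ∀ v, ((Finset.univ.filter (G.Adj v)).card : ℝ) ≤ d) (I : Finset V) :
    ∑ v, ((if v ∈ I then d else 0) + ((I.filter (G.Adj v)).card : ℝ)) ≤ 2 * d * I.card := by
  rw [Finset.sum_add_distrib]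
  have h1 : ∑ v, (if v ∈ I then d else 0) = d * I.card := by
    rw [Finset.sum_ite_mem, Finset.univ_inter, Finset.sum_const, nsmul_eq_mul, mul_comm]
  have h2 : ∑ v, (I.filter (G.Adj v)).card = ∑ u ∈ I, (Finset.univ.filter (G.Adj u)).card := by
    simp_rw [Finset.card_filter]
    rw [Finset.sum_comm]
    exact Finset.sum_congr rfl fun u _ => Finset.sum_congr rfl fun v _ =>
      if_congr (G.adj_comm v u) rfl rfl
  have h3 : ∑ u ∈ I, ((Finset.univ.filter (G.Adj u)).card : ℝ) ≤ I.card * d := by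
    rw [← nsmul_eq_mul]
    exact Finset.sum_le_card_nsmul _ _ _ fun u _ => hdeg u
  have h4 : ∑ v, ((I.filter (G.Adj v)).card : ℝ) =
      ∑ u ∈ I, ((Finset.univ.filter (G.Adj u)).card : ℝ) := by exact_mod_cast h2
  rw [h1, h4]
  linarith

/-- Graphs of maximum degree at most `d` whose neighbourhoods are sparse have independent sets
larger by a factor of order `log d` than the greedy bound. -/
theorem exists_indep_of_locally_sparse {V : Type*} [Fintype V] (G : SimpleGraph V) {K : ℕ}
    (hK : 0 < K) (hsparse : ∀ v, ∀ S : Finset V, (∀ u ∈ S, G.Adj v u) →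
      ∑ u ∈ S, (S.filter (G.Adj u)).card ≤ K * S.card) {d : ℝ} (hd : 1 ≤ d)
    (hdeg : ∀ v, ((Finset.univ.filter (G.Adj v)).card : ℝ) ≤ d) :
    ∃ I : Finset V, G.IsIndepSet (I : Set V) ∧
      1 / (8 * 2 ^ (2 * K + 2)) * (Fintype.card V * (Real.log d / d)) ≤ I.card := by
  set c : ℝ := 1 / 2 ^ (2 * K + 2) with hc
  set F := indepSubsets G Finset.univ with hF
  -- Double counting: each vertex receives average weight at least `c / 4 * log d`, while a set `I`
  -- distributes at most `2 * d * |I|`, so some `I` is at least as large as the average requires.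
  have htotal : ∑ _I ∈ F, (Fintype.card V * (c / 4 * Real.log d)) ≤
      ∑ I ∈ F, 2 * d * (I.card : ℝ) := by
    refine le_trans ?_ (Finset.sum_le_sum fun I _ => sum_weight_le G hdeg I)
    rw [Finset.sum_comm, Finset.sum_const, nsmul_eq_mul]
    refine le_trans (le_of_eq ?_) (Finset.sum_le_sum fun v _ =>
      log_mul_card_le_sum_weight G hK v (hsparse v) hd)
    rw [Finset.sum_const, nsmul_eq_mul, Finset.card_univ]
    ring
  obtain ⟨I, hI, hle⟩ := Finset.exists_le_of_sum_le ⟨∅, empty_mem_indepSubsets G _⟩ htotal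
  refine ⟨I, (mem_indepSubsets.mp hI).2, ?_⟩
  have hd0 : 0 < d := by linarith
  have : 1 / (8 * 2 ^ (2 * K + 2)) * (Fintype.card V * (Real.log d / d)) =
      (Fintype.card V * (c / 4 * Real.log d)) / (2 * d) := by
    rw [hc]
    field_simp
    ring
  rw [this, div_le_iff₀ (by positivity)]
  linarith

/-- The half of small maximum degree `d = 56 l n^(1/l)` is locally sparse, and `log d ≥ (log n) /
l`, so the gain is of order `log n`. -/
theorem exists_indep_of_evenCycle_free {l : ℕ} (hl : 2 ≤ l) :
    ∃ c : ℝ, 0 < c ∧ ∀ (V : Type u) [Fintype V] (G : SimpleGraph V), 3 ≤ Fintype.card V →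
      (SimpleGraph.cycleGraph (2 * l)).Free G → ∃ I : Finset V, G.IsIndepSet (I : Set V) ∧
        c * (Fintype.card V / ((Fintype.card V : ℝ) ^ ((1 : ℝ) / l) /
          Real.log (Fintype.card V))) ≤ I.card := by
  have hlR : (2 : ℝ) ≤ l := by exact_mod_cast hl
  set c₀ : ℝ := 1 / (8 * 2 ^ (2 * (4 * (2 * l)) + 2)) with hc₀
  have hc₀0 : 0 < c₀ := by positivity
  refine ⟨c₀ / (2 * l * (56 * l)), by positivity, ?_⟩
  intro V _ G hn hfree
  obtain ⟨S, hS, hdeg⟩ := exists_half_degree_le_of_evenCycle_free hl hfree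
  set n : ℝ := (Fintype.card V : ℝ) with hnR
  have hn3 : (3 : ℝ) ≤ n := by rw [hnR]; exact_mod_cast hn
  set q : ℝ := n ^ ((1 : ℝ) / l) with hq
  have hq1 : 1 ≤ q := Real.one_le_rpow (by linarith) (by positivity)
  have hlog : 0 < Real.log n := Real.log_pos (by linarith)
  set d : ℝ := 56 * l * q with hd
  have hqd : q ≤ d := by nlinarith
  obtain ⟨I, hI, hcard⟩ := exists_indep_of_locally_sparse (restrict G S)
    (K := 4 * (2 * l)) (by omega)
    (fun v X hX => sum_card_neighbors_le_of_subset_neighbors (by omega)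
      (free_restrict hfree S) v X hX) (d := d) (by linarith)
    (fun v => by rw [card_neighbors_restrict]; exact hdeg v v.2)
  obtain ⟨-, h2, h3⟩ := exists_indep_of_restrict hI
  refine ⟨_, h2, ?_⟩
  rw [h3]
  refine le_trans ?_ hcard
  rw [← hc₀, Fintype.card_coe]
  have hSR : n / 2 ≤ S.card := by
    have : n ≤ 2 * S.card := by rw [hnR]; exact_mod_cast hS
    linarith
  have hlogd : Real.log n / l ≤ Real.log d := by
    have h1 := Real.log_le_log (by linarith) hqd
    rw [hq, Real.log_rpow (by linarith)] at h1
    calc Real.log n / l = 1 / l * Real.log n := by ring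
      _ ≤ _ := h1
  have heq : c₀ / (2 * l * (56 * l)) * (n / (q / Real.log n)) =
      c₀ * (n / 2 * (Real.log n / l / d)) := by
    rw [hd]
    field_simp
  rw [heq]
  have hd0 : 0 < d := by linarith
  gcongr

/-! ### Greedy choice and graphs without an odd cycle. -/

/-- Repeatedly choosing independent sets with small closed neighbourhood. -/
lemma exists_indep_greedy {V : Type*} (G : SimpleGraph V) {h ρ : ℝ}
    (hstep : ∀ R : Finset V, h ≤ R.card → ∃ I ⊆ R, I.Nonempty ∧ G.IsIndepSet (I : Set V) ∧
      ((R.filter (fun w => w ∈ I ∨ ∃ u ∈ I, G.Adj u w)).card : ℝ) ≤ ρ * I.card) :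
    ∀ R : Finset V, ∃ I ⊆ R, G.IsIndepSet (I : Set V) ∧ (R.card : ℝ) - h ≤ ρ * I.card := by
  intro R
  induction R using Finset.strongInduction with
  | H R ih =>
    rcases lt_or_ge (R.card : ℝ) h with hlt | hge
    · exact ⟨∅, by simp, by simp [SimpleGraph.IsIndepSet], by simp; linarith⟩
    obtain ⟨I₀, hI₀R, ⟨x, hx⟩, hI₀, hcard⟩ := hstep R hge
    set B := R.filter (fun w => w ∈ I₀ ∨ ∃ u ∈ I₀, G.Adj u w) with hB
    have hBR : B ⊆ R := Finset.filter_subset _ _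
    have hlt : R \ B ⊂ R := by
      refine Finset.sdiff_ssubset hBR ⟨x, ?_⟩
      exact Finset.mem_filter.mpr ⟨hI₀R hx, Or.inl hx⟩
    obtain ⟨I₁, hI₁R, hI₁, hcard₁⟩ := ih _ hlt
    have hI₁' : ∀ w ∈ I₁, w ∉ I₀ ∧ ∀ u ∈ I₀, ¬ G.Adj u w := by
      intro w hw
      have := Finset.mem_sdiff.mp (hI₁R hw)
      rw [hB, Finset.mem_filter] at this
      refine ⟨fun h => this.2 ⟨this.1, Or.inl h⟩, fun u hu h => this.2 ⟨this.1, Or.inr ⟨u, hu, h⟩⟩⟩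
    have hdisj : Disjoint I₀ I₁ :=
      Finset.disjoint_left.mpr fun w hw hw' => (hI₁' w hw').1 hw
    refine ⟨I₀ ∪ I₁, Finset.union_subset hI₀R (hI₁R.trans Finset.sdiff_subset), ?_, ?_⟩
    · intro y hy z hz hyz
      rw [Finset.mem_coe, Finset.mem_union] at hy hz
      rcases hy with hy | hy <;> rcases hz with hz | hz
      · exact hI₀ hy hz hyz
      · exact (hI₁' z hz).2 y hy
      · exact fun h => (hI₁' y hy).2 z hz h.symm
      · exact hI₁ hy hz hyz
    · have h1 : ((R \ B).card : ℝ) + B.card = R.card := by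
        exact_mod_cast Finset.card_sdiff_add_card_eq_card hBR
      rw [Finset.card_union_of_disjoint hdisj]
      push_cast
      linarith

/-- In a graph without a cycle of length `2 l + 1`, the layers around a vertex of large degree
either grow until one of them contains a large independent set, or one of them contains an
independent set with a small closed neighbourhood. -/
lemma exists_indep_of_large_degree {V : Type*} [Fintype V] {G : SimpleGraph V} {l : ℕ}
    (hl : 1 ≤ l) (hfree : (SimpleGraph.cycleGraph (2 * l + 1)).Free G) {q L : ℝ} (hq : 1 ≤ q)
    (hL : 1 ≤ L) (v : V) (hv : q * L ≤ (Finset.univ.filter (G.Adj v)).card) :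
    (∃ I : Finset V, G.IsIndepSet (I : Set V) ∧ L * q ^ l ≤ (2 * l + 1 : ℕ) * I.card) ∨
    ∃ I : Finset V, I.Nonempty ∧ G.IsIndepSet (I : Set V) ∧
      ((Finset.univ.filter (fun w => w ∈ I ∨ ∃ u ∈ I, G.Adj u w)).card : ℝ) ≤
        (3 * (2 * l + 1 : ℕ) * q) * I.card := by
  obtain ⟨T⟩ := exists_searchTree G l v
  by_contra! hcon
  obtain ⟨hcon₁, hcon₂⟩ := hcon
  -- The closed neighbourhood of an independent set `I` in layer `i + 1` lies in layers `i` to `i +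
  -- 2`. If it has more than `3 m q |I|` vertices with `m = 2 * l + 1`, hence at least `3 q` times
  -- the layer, two of the three parts cover layers `i` and `i + 1` and layer `i + 2` is at least
  -- `q` times larger.
  have hgrow : ∀ i, i + 1 ≤ l → ((T.layer i).card : ℝ) ≤ (T.layer (i + 1)).card ∧
      L * q ^ (i + 1) ≤ (T.layer (i + 1)).card := by
    intro i
    induction i with
    | zero =>
      intro _
      have hsub : Finset.univ.filter (G.Adj v) ⊆ T.layer (0 + 1) := by
        intro u hu
        simp only [Finset.mem_filter, Finset.mem_univ, true_and] at hu
        have h0 := (T.lev_eq_zero v).mpr rfl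
        have h1 := T.lev_adj v u hu (by omega)
        have h2 : T.lev u ≠ 0 := fun h => hu.ne ((T.lev_eq_zero u).mp h).symm
        rw [T.mem_layer]
        omega
      have h1 : ((Finset.univ.filter (G.Adj v)).card : ℝ) ≤ (T.layer (0 + 1)).card := by
        exact_mod_cast Finset.card_le_card hsub
      rw [T.card_layer_zero]
      constructor
      · push_cast
        nlinarith
      · rw [zero_add, pow_one] at *
        linarith
    | succ i ih =>
      intro hi
      obtain ⟨h1, h2⟩ := ih (by omega)
      obtain ⟨I, hIsub, hI, hcard⟩ := T.exists_indep_layer hfree (i := i + 1) (by omega) (by omega)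
      have hpos : (0 : ℝ) < (T.layer (i + 1)).card := lt_of_lt_of_le (by positivity) h2
      have hcardR : ((T.layer (i + 1)).card : ℝ) ≤ (2 * l + 1 : ℕ) * I.card := by
        exact_mod_cast hcard
      have hIne : I.Nonempty := by
        rw [Finset.nonempty_iff_ne_empty]
        rintro rfl
        simp only [Finset.card_empty, Nat.cast_zero, mul_zero] at hcardR
        linarith
      have hlarge := hcon₂ I hIne hI
      have hsub : Finset.univ.filter (fun w => w ∈ I ∨ ∃ u ∈ I, G.Adj u w) ⊆
          T.layer i ∪ (T.layer (i + 1) ∪ T.layer (i + 1 + 1)) := by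
        intro w hw
        simp only [Finset.mem_filter, Finset.mem_univ, true_and] at hw
        rw [Finset.mem_union, Finset.mem_union, T.mem_layer, T.mem_layer, T.mem_layer]
        rcases hw with hw | ⟨u, hu, hadj⟩
        · exact Or.inr (Or.inl (T.mem_layer.mp (hIsub hw)))
        · have hu' := T.mem_layer.mp (hIsub hu)
          have h3 := T.lev_adj u w hadj (by omega)
          have h4 : i ≤ T.lev w := by
            by_contra! h
            have := T.lev_adj w u hadj.symm (by omega)
            omega
          omega
      have hle : ((Finset.univ.filter (fun w => w ∈ I ∨ ∃ u ∈ I, G.Adj u w)).card : ℝ) ≤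
          (T.layer i).card + ((T.layer (i + 1)).card + (T.layer (i + 1 + 1)).card) := by
        have := (Finset.card_le_card hsub).trans ((Finset.card_union_le _ _).trans
          (Nat.add_le_add_left (Finset.card_union_le _ _) _))
        exact_mod_cast this
      have hnext : q * (T.layer (i + 1)).card ≤ (T.layer (i + 1 + 1)).card := by
        have h5 : 3 * q * (T.layer (i + 1)).card ≤ (3 * (2 * l + 1 : ℕ) * q) * I.card := by
          have := mul_le_mul_of_nonneg_left hcardR (show 0 ≤ 3 * q by linarith)
          linarith
        nlinarith
      refine ⟨by nlinarith, ?_⟩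
      have h6 : q * (L * q ^ (i + 1)) ≤ q * (T.layer (i + 1)).card :=
        mul_le_mul_of_nonneg_left h2 (by linarith)
      calc L * q ^ (i + 1 + 1) = q * (L * q ^ (i + 1)) := by ring
        _ ≤ _ := h6.trans hnext
  obtain ⟨I, -, hI, hcard⟩ := T.exists_indep_layer hfree (i := l) le_rfl (by omega)
  have h1 := (hgrow (l - 1) (by omega)).2
  rw [Nat.sub_add_cancel hl] at h1
  have hcardR : ((T.layer l).card : ℝ) ≤ (2 * l + 1 : ℕ) * I.card := by exact_mod_cast hcard
  exact absurd (hcon₁ I hI) (not_lt.mpr (h1.trans hcardR))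

theorem exists_indep_of_oddCycle_free {l : ℕ} (hl : 1 ≤ l) :
    ∃ c : ℝ, 0 < c ∧ ∀ (V : Type u) [Fintype V] (G : SimpleGraph V), 3 ≤ Fintype.card V →
      (SimpleGraph.cycleGraph (2 * l + 1)).Free G → ∃ I : Finset V, G.IsIndepSet (I : Set V) ∧
        c * (Fintype.card V / ((Fintype.card V : ℝ) / Real.log (Fintype.card V)) ^
          ((1 : ℝ) / (l + 1))) ≤ I.card := by
  set m : ℝ := ((2 * l + 1 : ℕ) : ℝ) with hm
  have hm1 : 1 ≤ m := by rw [hm]; exact_mod_cast Nat.le_add_left 1 (2 * l)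
  set c₀ : ℝ := 1 / (8 * 2 ^ (2 * (4 * (2 * l + 1)) + 2)) with hc₀
  have hc₀0 : 0 < c₀ := by positivity
  have hc₀1 : c₀ ≤ 1 := by
    rw [hc₀, div_le_one (by positivity)]
    have : (1 : ℝ) ≤ 2 ^ (2 * (4 * (2 * l + 1)) + 2) := one_le_pow₀ (by norm_num)
    linarith
  refine ⟨c₀ / (6 * m * (l + 1)), by positivity, ?_⟩
  intro V _ G hn hfree
  set n : ℝ := (Fintype.card V : ℝ) with hnR
  have hn3 : (3 : ℝ) ≤ n := by rw [hnR]; exact_mod_cast hn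
  set L := Real.log n with hLdef
  have hL : 1 ≤ L := by
    rw [hLdef, Real.le_log_iff_exp_le (by linarith)]
    exact Real.exp_one_lt_d9.le.trans (by linarith)
  have hLn : L ≤ n := by
    have := Real.log_le_sub_one_of_pos (show 0 < n by linarith)
    linarith
  set q : ℝ := (n / L) ^ ((1 : ℝ) / (l + 1)) with hq
  have hq1 : 1 ≤ q := Real.one_le_rpow ((one_le_div (by linarith)).mpr hLn) (by positivity)
  have hq0 : 0 < q := by linarith
  have hqpow : q ^ (l + 1) = n / L := by
    have : (1 : ℝ) / (l + 1) = ((l + 1 : ℕ) : ℝ)⁻¹ := by push_cast; rw [one_div]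
    rw [hq, this, Real.rpow_inv_natCast_pow (by positivity) (by omega)]
  have hqL : L * q ^ l = n / q := by
    rw [pow_succ] at hqpow
    field_simp at hqpow ⊢
    linarith
  have hl0 : (0 : ℝ) ≤ l := Nat.cast_nonneg l
  -- The three cases produce different constants; the announced one is below each of them.
  have hcoef : ∀ c' : ℝ, c₀ / (6 * m * (l + 1)) ≤ c' → ∀ x : ℝ, c' * (n / q) ≤ x →
      c₀ / (6 * m * (l + 1)) * (n / q) ≤ x := fun c' hc' x hx =>
    (mul_le_mul_of_nonneg_right hc' (by positivity)).trans hx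
  by_cases hA : ∃ R : Finset V, n / 2 ≤ R.card ∧
      ∀ v ∈ R, ((R.filter (G.Adj v)).card : ℝ) ≤ q * L
  · obtain ⟨R, hR, hdeg⟩ := hA
    obtain ⟨I, hI, hcard⟩ := exists_indep_of_locally_sparse (restrict G R)
      (K := 4 * (2 * l + 1)) (by omega)
      (fun v X hX => sum_card_neighbors_le_of_subset_neighbors (by omega)
        (free_restrict hfree R) v X hX) (d := q * L) (by nlinarith)
      (fun v => by rw [card_neighbors_restrict]; exact hdeg v v.2)
    obtain ⟨-, h2, h3⟩ := exists_indep_of_restrict hI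
    refine ⟨_, h2, ?_⟩
    rw [h3]
    rw [← hc₀, Fintype.card_coe] at hcard
    have hlogd : L / (l + 1) ≤ Real.log (q * L) := by
      -- The degree bound `q * L` is at least `n^(1/(l+1))`, so its logarithm cancels the factor `L`
      -- in the degree up to a constant, leaving order `n / q`.
      have h4 : n ≤ (q * L) ^ (l + 1) := by
        rw [mul_pow, hqpow, pow_succ]
        have : (1 : ℝ) ≤ L ^ l := one_le_pow₀ hL
        calc n ≤ n * L ^ l := le_mul_of_one_le_right (by linarith) this
          _ = n / L * (L ^ l * L) := by field_simp
      have h5 := Real.log_le_log (by linarith) h4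
      rw [Real.log_pow] at h5
      rw [div_le_iff₀ (by positivity)]
      push_cast at h5
      linarith
    have h6 : c₀ * (n / 2 * (L / (l + 1) / (q * L))) ≤ I.card := by
      refine le_trans ?_ hcard
      gcongr
    refine hcoef (c₀ / (2 * (l + 1))) ?_ _ (le_trans (le_of_eq ?_) h6)
    · gcongr
      linarith
    · field_simp
  push Not at hA
  by_cases hB : ∃ I : Finset V, G.IsIndepSet (I : Set V) ∧ L * q ^ l ≤ m * I.card
  · obtain ⟨I, hI, hcard⟩ := hB
    refine ⟨I, hI, hcoef (1 / m) ?_ _ ?_⟩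
    · apply div_le_div₀ (by norm_num) hc₀1 (by linarith)
      nlinarith
    · rw [hqL] at hcard
      rw [one_div, inv_mul_le_iff₀ (by linarith)]
      exact hcard
  push Not at hB
  -- With the first two cases excluded, every set of at least `n / 2` vertices has a vertex of large
  -- degree and hence a cheap independent set. The process stops below `n / 2`, having removed at
  -- least `n / 2` vertices at cost `3 * m * q` each.
  obtain ⟨I, -, hI, hcard⟩ := exists_indep_greedy G (h := n / 2) (ρ := 3 * m * q)
    (fun R hR => by
      obtain ⟨v, hvR, hv⟩ := hA R hR
      rcases exists_indep_of_large_degree hl (free_restrict hfree R) hq1 hL ⟨v, hvR⟩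
        (by rw [card_neighbors_restrict]; exact hv.le) with ⟨I, hI, hcard⟩ | ⟨I, hne, hI, hcard⟩
      · obtain ⟨-, h2, h3⟩ := exists_indep_of_restrict hI
        have := hB _ h2
        rw [h3] at this
        exact absurd hcard (not_le.mpr this)
      · obtain ⟨h1, h2, h3⟩ := exists_indep_of_restrict hI
        refine ⟨_, h1, by simpa using hne, h2, ?_⟩
        rw [h3]
        refine le_trans ?_ hcard
        have hsub : R.filter (fun w => w ∈ I.map (Function.Embedding.subtype (· ∈ R)) ∨
            ∃ u ∈ I.map (Function.Embedding.subtype (· ∈ R)), G.Adj u w) ⊆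
            (Finset.univ.filter (fun w => w ∈ I ∨ ∃ u ∈ I, (restrict G R).Adj u w)).map
              (Function.Embedding.subtype (· ∈ R)) := by
          intro w hw
          obtain ⟨hwR, hw⟩ := Finset.mem_filter.mp hw
          refine Finset.mem_map.mpr ⟨⟨w, hwR⟩, ?_, rfl⟩
          refine Finset.mem_filter.mpr ⟨Finset.mem_univ _, ?_⟩
          rcases hw with hw | ⟨u, hu, hadj⟩
          · obtain ⟨w', hw', rfl⟩ := Finset.mem_map.mp hw
            exact Or.inl hw'
          · obtain ⟨u', hu', rfl⟩ := Finset.mem_map.mp hu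
            exact Or.inr ⟨u', hu', hadj⟩
        have := Finset.card_le_card hsub
        rw [Finset.card_map] at this
        refine (Nat.cast_le.mpr this).trans (le_of_eq ?_)
        congr!) Finset.univ
  refine ⟨I, hI, hcoef (1 / (6 * m)) ?_ _ ?_⟩
  · apply div_le_div₀ (by norm_num) hc₀1 (by linarith)
    nlinarith
  · rw [Finset.card_univ] at hcard
    have : n / 2 ≤ 3 * m * q * I.card := by linarith
    rw [one_div, inv_mul_le_iff₀ (by positivity), div_le_iff₀ hq0]
    linarith

/-! ### From independent sets to colourings. -/

/-- Colouring by repeatedly removing large independent sets. -/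
lemma exists_coloring_of_indep {V : Type*} (G : SimpleGraph V) {a c s : ℝ} (ha0 : 0 < a)
    (ha1 : a ≤ 1) (hc : 0 < c) (hs : 0 < s)
    (hind : ∀ R : Finset V, s ≤ R.card → ∃ I ⊆ R, G.IsIndepSet (I : Set V) ∧
      c * (R.card / (R.card : ℝ) ^ a) ≤ I.card) :
    ∀ R : Finset V, ∃ k : ℕ, (k : ℝ) ≤ s + 1 / (a * c) * (R.card : ℝ) ^ a ∧
      ∃ f : V → ℕ, (∀ u ∈ R, f u < k) ∧ ∀ u ∈ R, ∀ w ∈ R, G.Adj u w → f u ≠ f w := by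
  intro R
  induction R using Finset.strongInduction with
  | H R ih =>
    rcases lt_or_ge (R.card : ℝ) s with hlt | hge
    · refine ⟨R.card, hlt.le.trans (le_add_of_nonneg_right (by positivity)),
        fun u => if hu : u ∈ R then (R.equivFin ⟨u, hu⟩).val else 0, fun u hu => ?_, ?_⟩
      · simp [hu]
      · intro u hu w hw hadj h
        simp only [hu, hw, dif_pos] at h
        have := R.equivFin.injective (Fin.ext h)
        exact hadj.ne (congrArg Subtype.val this)
    obtain ⟨I, hIR, hI, hcard⟩ := hind R hge
    have hR0 : (0 : ℝ) < R.card := hs.trans_le hge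
    have hRa : 0 < (R.card : ℝ) ^ a := by positivity
    have hI0 : (0 : ℝ) < I.card := lt_of_lt_of_le (by positivity) hcard
    obtain ⟨x, hx⟩ := Finset.card_pos.mp (by exact_mod_cast hI0 : 0 < I.card)
    obtain ⟨k, hk, f, hfk, hf⟩ := ih (R \ I) (Finset.sdiff_ssubset hIR ⟨x, hx⟩)
    refine ⟨k + 1, ?_, fun u => if u ∈ I then k else f u, ?_, ?_⟩
    · have h1 : ((R \ I).card : ℝ) = R.card * (1 + -(I.card / R.card)) := by
        have : ((R \ I).card : ℝ) + I.card = R.card := by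
          exact_mod_cast Finset.card_sdiff_add_card_eq_card hIR
        field_simp
        linarith
      have hIle : (I.card : ℝ) / R.card ≤ 1 := by
        rw [div_le_one hR0]
        exact_mod_cast Finset.card_le_card hIR
      -- Bernoulli's inequality for `a ≤ 1`: removing `I` lowers the potential `|R|^a / (a c)` by at
      -- least `1`, which pays for the new colour.
      have h2 : ((R \ I).card : ℝ) ^ a ≤ (R.card : ℝ) ^ a * (1 + a * -(I.card / R.card)) := by
        rw [h1, Real.mul_rpow hR0.le (by linarith)]
        exact mul_le_mul_of_nonneg_left
          (rpow_one_add_le_one_add_mul_self (by linarith) ha0.le ha1) hRa.le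
      have h3 : 1 ≤ 1 / (a * c) * ((R.card : ℝ) ^ a * (a * (I.card / R.card))) := by
        have h4 : c * R.card ≤ I.card * (R.card : ℝ) ^ a := by
          rw [← mul_div_assoc, div_le_iff₀ hRa] at hcard
          exact hcard
        have h5 : 1 / (a * c) * ((R.card : ℝ) ^ a * (a * (I.card / R.card))) =
            (I.card * (R.card : ℝ) ^ a) / (c * R.card) := by
          field_simp
        rw [h5, one_le_div (by positivity)]
        exact h4
      have h6 := mul_le_mul_of_nonneg_left h2 (show 0 ≤ 1 / (a * c) by positivity)
      push_cast
      linarith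
    · intro u hu
      by_cases huI : u ∈ I
      · simp [huI]
      · simp only [huI, if_false]
        exact (hfk u (Finset.mem_sdiff.mpr ⟨hu, huI⟩)).trans (Nat.lt_succ_self k)
    · intro u hu w hw hadj
      by_cases huI : u ∈ I <;> by_cases hwI : w ∈ I <;> simp only [huI, hwI, if_true, if_false]
      · exact absurd hadj (hI huI hwI hadj.ne)
      · exact (hfk w (Finset.mem_sdiff.mpr ⟨hw, hwI⟩)).ne'
      · exact (hfk u (Finset.mem_sdiff.mpr ⟨hu, huI⟩)).ne
      · exact hf u (Finset.mem_sdiff.mpr ⟨hu, huI⟩) w (Finset.mem_sdiff.mpr ⟨hw, hwI⟩) hadj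

/-- If all graphs without a copy of `H` have independent sets of size of order
`n / (n ^ a / log n ^ b)`, then they have chromatic number of order at most `n ^ a / log n ^ b`. -/
theorem exists_chromaticNumber_le_of_indep {W : Type*} (H : SimpleGraph W) {a b c : ℝ}
    (ha0 : 0 < a) (ha1 : a ≤ 1) (hb : 0 < b) (hc : 0 < c) (N₀ : ℕ)
    (hind : ∀ (V : Type u) [Fintype V] (G : SimpleGraph V), N₀ ≤ Fintype.card V → H.Free G →
      ∃ I : Finset V, G.IsIndepSet (I : Set V) ∧ c * (Fintype.card V /
        ((Fintype.card V : ℝ) ^ a / Real.log (Fintype.card V) ^ b)) ≤ I.card) :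
    ∃ C : ℝ, 0 < C ∧ ∃ N : ℕ, ∀ n : ℕ, N ≤ n →
      ∀ (V : Type u) [Fintype V] (G : SimpleGraph V), Fintype.card V = n → H.Free G →
        ∃ k : ℕ, G.chromaticNumber = (k : ℕ∞) ∧
          (k : ℝ) ≤ C * ((n : ℝ) ^ a / Real.log n ^ b) := by
  set c' : ℝ := c * (a / 2) ^ b with hc'
  have hc'0 : 0 < c' := by positivity
  have hev : ∀ᶠ n : ℕ in Filter.atTop, Real.log n ^ b ≤ (n : ℝ) ^ (a / 2) := by
    have h1 := (isLittleO_log_rpow_rpow_atTop b (half_pos ha0)).bound (show (0 : ℝ) < 1 by norm_num)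
    filter_upwards [tendsto_natCast_atTop_atTop.eventually h1, Filter.eventually_ge_atTop 1]
      with n hn hn1
    have hlog : 0 ≤ Real.log (n : ℝ) := Real.log_nonneg (by exact_mod_cast hn1)
    rw [one_mul, Real.norm_of_nonneg (by positivity), Real.norm_of_nonneg (by positivity)] at hn
    exact hn
  have hev2 : ∀ᶠ n : ℕ in Filter.atTop, (N₀ : ℝ) ≤ (n : ℝ) ^ (a / 2) :=
    ((tendsto_rpow_atTop (half_pos ha0)).comp tendsto_natCast_atTop_atTop).eventually_ge_atTop _
  obtain ⟨N, hN⟩ := Filter.eventually_atTop.mp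
    (hev.and (hev2.and (Filter.eventually_ge_atTop 3)))
  refine ⟨1 + 1 / (a * c'), by positivity, N, ?_⟩
  intro n hn V _ G hcard hfree
  obtain ⟨hn1, hn2, hn3⟩ := hN n hn
  have hn3' : (3 : ℝ) ≤ n := by exact_mod_cast hn3
  have hlog : 0 < Real.log (n : ℝ) := Real.log_pos (by linarith)
  have hlogb : 0 < Real.log (n : ℝ) ^ b := by positivity
  have hs1 : 1 < (n : ℝ) ^ (a / 2) := Real.one_lt_rpow (by linarith) (by linarith)
  -- The threshold `n^(a/2)` is large enough that `log |R| ≥ (a/2) log n` throughout, so the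
  -- logarithmic gain survives up to a constant, yet small enough that giving each leftover vertex
  -- its own colour stays within `n^a / (log n)^b`.
  obtain ⟨k, hk, f, hfk, hf⟩ := exists_coloring_of_indep G (a := a)
    (c := c' * Real.log n ^ b) (s := (n : ℝ) ^ (a / 2)) ha0 ha1 (by positivity) (by positivity)
    (fun R hR => by
      have hR1 : (1 : ℝ) < R.card := hs1.trans_le hR
      obtain ⟨I, hI, hle⟩ := hind R (restrict G R) (by
        rw [Fintype.card_coe]
        exact_mod_cast hn2.trans hR) (free_restrict hfree R)
      obtain ⟨h1, h2, h3⟩ := exists_indep_of_restrict hI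
      refine ⟨_, h1, h2, ?_⟩
      rw [h3]
      refine le_trans ?_ hle
      rw [Fintype.card_coe]
      have hlogR : a / 2 * Real.log n ≤ Real.log R.card := by
        rw [← Real.log_rpow (by linarith)]
        exact Real.log_le_log (by linarith) hR
      have hpow : (a / 2) ^ b * Real.log n ^ b ≤ Real.log R.card ^ b := by
        rw [← Real.mul_rpow (by positivity) hlog.le]
        exact Real.rpow_le_rpow (by positivity) hlogR hb.le
      calc c' * Real.log n ^ b * (R.card / (R.card : ℝ) ^ a)
          = c * (R.card / (R.card : ℝ) ^ a) * ((a / 2) ^ b * Real.log n ^ b) := by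
            rw [hc']; ring
        _ ≤ c * (R.card / (R.card : ℝ) ^ a) * Real.log R.card ^ b := by gcongr
        _ = _ := by
          rw [div_div_eq_mul_div]
          ring) Finset.univ
  rw [Finset.card_univ, hcard] at hk
  have hcol : G.Colorable k := ⟨SimpleGraph.Coloring.mk
    (fun v => (⟨f v, hfk v (Finset.mem_univ v)⟩ : Fin k)) fun {u w} hadj h =>
      hf u (Finset.mem_univ u) w (Finset.mem_univ w) hadj (congrArg Fin.val h)⟩
  have hle := hcol.chromaticNumber_le
  obtain ⟨χ, hχ⟩ := ENat.ne_top_iff_exists.mp (ne_top_of_le_ne_top (ENat.natCast_ne_top k) hle)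
  refine ⟨χ, hχ.symm, ?_⟩
  rw [← hχ] at hle
  have hχk : (χ : ℝ) ≤ k := by exact_mod_cast hle
  refine hχk.trans (hk.trans ?_)
  have hs : (n : ℝ) ^ (a / 2) ≤ (n : ℝ) ^ a / Real.log n ^ b := by
    rw [le_div_iff₀ hlogb]
    calc (n : ℝ) ^ (a / 2) * Real.log n ^ b ≤ (n : ℝ) ^ (a / 2) * (n : ℝ) ^ (a / 2) := by gcongr
      _ = (n : ℝ) ^ a := by rw [← Real.rpow_add (by linarith), add_halves]
  have heq : 1 / (a * (c' * Real.log n ^ b)) * (n : ℝ) ^ a =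
      1 / (a * c') * ((n : ℝ) ^ a / Real.log n ^ b) := by
    field_simp
  rw [heq, add_mul, one_mul]
  linarith

end CycleFreeColoring

end

theorem mainTheorem7 (l : ℕ) (hl : 2 ≤ l) :
    (∃ C : ℝ, 0 < C ∧ ∃ N : ℕ, ∀ n : ℕ, N ≤ n →
      ∀ (V : Type u) [Fintype V] (G : SimpleGraph V), Fintype.card V = n →
        (SimpleGraph.cycleGraph (2 * l + 1)).Free G →
        ∃ k : ℕ, G.chromaticNumber = (k : ℕ∞) ∧
          (k : ℝ) ≤ C * ((n : ℝ) / Real.log (n : ℝ)) ^ ((1 : ℝ) / ((l : ℝ) + 1))) ∧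
    (∃ C : ℝ, 0 < C ∧ ∃ N : ℕ, ∀ n : ℕ, N ≤ n →
      ∀ (V : Type u) [Fintype V] (G : SimpleGraph V), Fintype.card V = n →
        (SimpleGraph.cycleGraph (2 * l)).Free G →
        ∃ k : ℕ, G.chromaticNumber = (k : ℕ∞) ∧
          (k : ℝ) ≤ C * ((n : ℝ) ^ ((1 : ℝ) / (l : ℝ)) / Real.log (n : ℝ))) := by
  have hlR : (2 : ℝ) ≤ l := by exact_mod_cast hl
  constructor
  · obtain ⟨c, hc, hind⟩ := CycleFreeColoring.exists_indep_of_oddCycle_free.{u} (l := l) (by omega)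
    have hdiv : ∀ n : ℕ, ((n : ℝ) / Real.log n) ^ ((1 : ℝ) / (l + 1)) =
        (n : ℝ) ^ ((1 : ℝ) / (l + 1)) / Real.log n ^ ((1 : ℝ) / (l + 1)) := fun n =>
      Real.div_rpow (Nat.cast_nonneg n) (Real.log_natCast_nonneg n) _
    simp only [hdiv] at hind ⊢
    exact CycleFreeColoring.exists_chromaticNumber_le_of_indep _ (by positivity)
      (by rw [div_le_one (by positivity)]; linarith) (by positivity) hc 3 hind
  · obtain ⟨c, hc, hind⟩ := CycleFreeColoring.exists_indep_of_evenCycle_free.{u} hl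
    have := CycleFreeColoring.exists_chromaticNumber_le_of_indep (b := 1)
      (SimpleGraph.cycleGraph (2 * l)) (a := (1 : ℝ) / l) (by positivity)
      (by rw [div_le_one (by positivity)]; linarith) one_pos hc 3
      (by simpa only [Real.rpow_one] using hind)
    simpa only [Real.rpow_one] using this
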